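/- Let $m\ge 1$ be an integer, $c>-1$ real, $\lambda=1/m$, and for $N\ge1$ let $Q(\zeta)=Q_N(\zeta)=|\zeta|^{2/m}-\frac{2c}{N}\log|\zeta|$. With $dA=\frac1\pi d^2\zeta$ put $$\langle h|g\rangle_N=\int_{\mathbb C}(\bar\zeta-\zeta)e^{-NQ(\zeta)}\big(h(\zeta)\overline{g(\zeta)}-\overline{h(\zeta)}g(\zeta)\big)\,dA(\zeta).$$ Real polynomials $q_k$ with $\deg q_k=k$ ($k\ge0$) are called skew-orthogonal if $\langle q_{2k+1}|q_{2l}\rangle_N=-\langle q_{2l}|q_{2k+1}\rangle_N=s_k\delta_{kl}$ with $s_k>0$, and $\langle q_{2k+1}|q_{2l+1}\rangle_N=\langle q_{2k}|q_{2l}\rangle_N=0$. With $r_N=(\lambda N/2)^{-1/(2\lambda)}$ define the pre-kernel rescaled at the origin $$\kappa_N(z,w)=r_N^3\sum_{k=0}^{N-1}\frac{q_{2k+1}(r_Nz)q_{2k}(r_Nw)-q_{2k}(r_Nz)q_{2k+1}(r_Nw)}{s_k}.$$ Define $$E_{a,b}(z)=\sum_{k\ge0}\frac{z^k}{\Gamma(ak+b)},\qquad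 E_{\alpha,\mu,l}(z)=1+\sum_{k\ge1}z^k\prod_{j=0}^{k-1}\frac{\Gamma(\alpha(j\mu+l)+1)}{\Gamma(\alpha(j\mu+l+1)+1)},$$ $$F_{m,c}(z)=z^{m(1+c)-1}E_{2m,m(1+c)}(z^{2m}),\qquad g_{j,m}(z)=z^{j-1}E_{m,2,1+\frac{j-1}{m}}(z^{2m})\quad(1\le j\le m),$$ let $W_{j,m}$ be the Wronskian of $g_{1,m},\dots,g_{m,m}$ with $g_{j,m}$ omitted, and $G(m+1)=\prod_{j=1}^{m-1}j!$. Set, for $m=1$, $$\widetilde\kappa_{1,c}(z,w)=\int_0^1\big(ze^{\frac12(1-s^2)z^2}-we^{\frac12(1-s^2)w^2}\big)F_{1,c}(szw)\,ds,$$ and for $m>1$ $$\widetilde\kappa_{\lambda,c}(z,w)=\sum_{j=1}^m\frac{(-1)^{m-j}}{G(m+1)}\int_0^1\big(zg_{j,m}(z)W_{j,m}(sz)-wg_{j,m}(w)W_{j,m}(sw)\big)F_{m,c}(szw)\,ds,$$ $$\kappa_{\lambda,c}(z,w)=\Big(\frac2\lambda\Big)^{\frac1{2\lambda}}(zw)^{\lambda-1}\,\widetilde\kappa_{\lambda,c}\Big(\sqrt{\tfrac2\lambda}\,z^\lambda,\sqrt{\tfrac2\lambda}\,w^\lambda\Big).$$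 Multivalued expressions are read as follows: for $z=e^Z$, $w=e^W$ with arbitrary $Z,W\in\mathbb C$, put $z^a=e^{aZ}$, $(zw)^a=e^{a(Z+W)}$, let $\sqrt{2/\lambda}\,z^\lambda$ carry the logarithm $\log\sqrt{2/\lambda}+\lambda Z$, let $szw$ carry the sum of the logarithms of $s$, $z$, $w$, and let $\bar z$ carry the logarithm $\overline Z$. **Theorem.** Skew-orthogonal polynomials exist for every $N\ge1$, the integrals above converge absolutely for all $z,w\ne0$, and for every choice of skew-orthogonal polynomials (one family for each $N$) the following hold. (i) $\kappa_{\lambda,c}$ is the limiting origin pre-kernel: with $h(z)=(z/|z|)^c=e^{ic\,\mathrm{Im}\,Z}$ and the cocycle $c_N(z,w)=h(z)h(w)$, as $N\to\infty$, $$e^{-\frac N2(Q(r_Nz)+Q(r_Nw))}\begin{pmatrix}(c_N\kappa_N)(z,w)&(c_N\kappa_N)(z,\bar w)\\(c_N\kappa_N)(\bar z,w)&(c_N\kappa_N)(\bar z,\bar w)\end{pmatrix}\to e^{-\frac{|z|^{2\lambda}+|w|^{2\lambda}}{\lambda}}\begin{pmatrix}\kappa_{\lambda,c}(z,w)&\kappa_{\lambda,c}(z,\bar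 w)\\\kappa_{\lambda,c}(\bar z,w)&\kappa_{\lambda,c}(\bar z,\bar w)\end{pmatrix}$$ uniformly for $(Z,W)$ in compact subsets of $\mathbb C^2$. (ii) $r_N^{2c}\kappa_N(z,w)$ converges, uniformly on compact subsets of $\mathbb C^2$, to an entire function $P(z,w)$, and $\kappa_{\lambda,c}(z,w)=(zw)^cP(z,w)$ for all $z,w\neq0$. -/

import Mathlib

open Filter Topology MeasureTheory
open scoped ComplexConjugate

noncomputable section

namespace MittagLefflerKernel

/-! ### The ensemble, its skew-orthogonal polynomials and its pre-kernel at finite `N` -/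

/-- The potential `Q(ζ) = |ζ|^{2λ} - (2c/N) log |ζ|`. -/
def potential (lam c : ℝ) (N : ℕ) (ζ : ℂ) : ℝ :=
  ‖ζ‖ ^ (2 * lam) - (2 * c / (N : ℝ)) * Real.log ‖ζ‖

/-- The anti-symmetric scalar product
`⟨h|g⟩ = ∫_ℂ (ζ̄ - ζ) e^{-N Q(ζ)} (h(ζ) conj(g(ζ)) - conj(h(ζ)) g(ζ)) dA(ζ)`,
where `dA` is the Lebesgue measure divided by `π`. -/
def skewProduct (N : ℕ) (Q : ℂ → ℝ) (h g : ℂ → ℂ) : ℂ :=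
  (1 / (Real.pi : ℂ)) *
    ∫ ζ : ℂ, (conj ζ - ζ) * (Real.exp (-(N : ℝ) * Q ζ) : ℂ) *
      (h ζ * conj (g ζ) - conj (h ζ) * g ζ)

/-- A real polynomial as a function on `ℂ`. -/
def polyFun (p : Polynomial ℝ) (ζ : ℂ) : ℂ := Polynomial.aeval ζ p

/-- `q 0, q 1, …` are skew-orthogonal polynomials (`q k` of degree `k`, with real coefficients)
associated with `Q`, with the positive skew-norms `s 0, s 1, …`. -/
structure IsSkewOrthogonal (N : ℕ) (Q : ℂ → ℝ) (q : ℕ → Polynomial ℝ) (s : ℕ → ℝ) : Prop where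
  degree_eq : ∀ k, (q k).degree = (k : WithBot ℕ)
  norm_pos : ∀ k, 0 < s k
  odd_even : ∀ k l, skewProduct N Q (polyFun (q (2 * k + 1))) (polyFun (q (2 * l))) =
    if k = l then (s k : ℂ) else 0
  even_odd : ∀ k l, skewProduct N Q (polyFun (q (2 * l))) (polyFun (q (2 * k + 1))) =
    if k = l then -(s k : ℂ) else 0
  odd_odd : ∀ k l, skewProduct N Q (polyFun (q (2 * k + 1))) (polyFun (q (2 * l + 1))) = 0
  even_even : ∀ k l, skewProduct N Q (polyFun (q (2 * k))) (polyFun (q (2 * l))) = 0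

/-- The pre-kernel `∑_{k<N} (q_{2k+1}(ζ) q_{2k}(η) - q_{2k}(ζ) q_{2k+1}(η)) / s_k`
before rescaling. -/
def preKernel (N : ℕ) (q : ℕ → Polynomial ℝ) (s : ℕ → ℝ) (ζ η : ℂ) : ℂ :=
  ∑ k ∈ Finset.range N,
    (polyFun (q (2 * k + 1)) ζ * polyFun (q (2 * k)) η -
      polyFun (q (2 * k)) ζ * polyFun (q (2 * k + 1)) η) / (s k : ℂ)

/-- The micro-scale at the origin, `r_N = (λ N / 2)^{-1/(2λ)}`. -/
def microScale (lam : ℝ) (N : ℕ) : ℝ := (lam / 2 * (N : ℝ)) ^ (-(1 / (2 * lam)))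

/-- The pre-kernel `κ_N(z, w)` rescaled at the origin. -/
def rescaledPreKernel (lam : ℝ) (N : ℕ) (q : ℕ → Polynomial ℝ) (s : ℕ → ℝ) (z w : ℂ) : ℂ :=
  (microScale lam N : ℂ) ^ 3 *
    preKernel N q s ((microScale lam N : ℂ) * z) ((microScale lam N : ℂ) * w)

/-! ### Kernels in logarithmic coordinates

Non-integer powers of `z` are multivalued.  Points `z, w ≠ 0` are therefore written as
`z = exp Z`, `w = exp W`, where `Z, W : ℂ` are arbitrary choices of their logarithms, and
`z ^ a = exp (a Z)`, `(z w) ^ a = exp (a (Z + W))`; the conjugate `z̄` carries the logarithm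
`conj Z`.  Taking `Z = Complex.log z` on the slit plane gives the principal branches. -/

/-- The unimodular function `h(z) = (z/|z|)^c`, `z = exp Z`. -/
def unimodular (c : ℝ) (Z : ℂ) : ℂ := Complex.exp (Complex.I * (c : ℂ) * (Z.im : ℂ))

/-- The `2 × 2` matrix formed from a pre-kernel: `(κ(z,w), κ(z,w̄); κ(z̄,w), κ(z̄,w̄))`. -/
def kernelMatrix (κ : ℂ → ℂ → ℂ) (Z W : ℂ) : Matrix (Fin 2) (Fin 2) ℂ :=
  !![κ Z W, κ Z (conj W); κ (conj Z) W, κ (conj Z) (conj W)]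

/-- The kernel `c_N · K_N` of the rescaled process at `z = exp Z`, `w = exp W`, where `c_N` is the
cocycle `h(z) h(w)`:
`e^{-(N/2)(Q(r_N z) + Q(r_N w))}` times the matrix of the pre-kernel `c_N(z,w) κ_N(z,w)`. -/
def finiteKernel (lam c : ℝ) (N : ℕ) (q : ℕ → Polynomial ℝ) (s : ℕ → ℝ) (Z W : ℂ) :
    Matrix (Fin 2) (Fin 2) ℂ :=
  (Real.exp (-((N : ℝ) / 2) *
      (potential lam c N ((microScale lam N : ℂ) * Complex.exp Z) +
        potential lam c N ((microScale lam N : ℂ) * Complex.exp W))) : ℂ) •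
    kernelMatrix
      (fun U V => unimodular c U * unimodular c V *
        rescaledPreKernel lam N q s (Complex.exp U) (Complex.exp V)) Z W

/-- `e^{-(|z|^{2λ} + |w|^{2λ})/λ}` times the matrix of the pre-kernel `κ`, at `z = exp Z`,
`w = exp W`. -/
def limitKernel (lam : ℝ) (κ : ℂ → ℂ → ℂ) (Z W : ℂ) : Matrix (Fin 2) (Fin 2) ℂ :=
  (Real.exp (-((‖Complex.exp Z‖ ^ (2 * lam) + ‖Complex.exp W‖ ^ (2 * lam)) / lam)) : ℂ) •
    kernelMatrix κ Z W

/-! ### The special functions -/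

/-- The two-parametric Mittag-Leffler function `E_{a,b}(z) = ∑_k z^k / Γ(a k + b)`. -/
def mittagLeffler (a b : ℝ) (z : ℂ) : ℂ :=
  ∑' k : ℕ, z ^ k / (Real.Gamma (a * k + b) : ℂ)

/-- The Kilbas–Saigo function
`E_{α,m,l}(z) = 1 + ∑_{k ≥ 1} z^k ∏_{j<k} Γ(α(jm+l)+1) / Γ(α(jm+l+1)+1)`
(the term `k = 0` of the sum below is `1`). -/
def kilbasSaigo (α m l : ℝ) (z : ℂ) : ℂ :=
  ∑' k : ℕ, z ^ k * ∏ j ∈ Finset.range k,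
    ((Real.Gamma (α * (j * m + l) + 1) / Real.Gamma (α * (j * m + l + 1) + 1) : ℝ) : ℂ)

/-- `F_{m,c}(z) = z^{m(1+c)-1} E_{2m, m(1+c)}(z^{2m})` at `z = exp ℓ`. -/
def FML (m : ℕ) (c : ℝ) (ℓ : ℂ) : ℂ :=
  Complex.exp (((m * (1 + c) - 1 : ℝ) : ℂ) * ℓ) *
    mittagLeffler (2 * m) (m * (1 + c)) (Complex.exp ℓ ^ (2 * m))

/-- `g_{j,m}(z) = z^{j-1} E_{m, 2, 1+(j-1)/m}(z^{2m})` for `1 ≤ j ≤ m`. -/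
def g (m j : ℕ) (z : ℂ) : ℂ :=
  z ^ (j - 1) * kilbasSaigo m 2 (1 + ((j : ℝ) - 1) / m) (z ^ (2 * m))

/-- The Wronskian of `n` functions, `det (f_k^{(i)}(z))_{i,k}`. -/
def wronskian {n : ℕ} (f : Fin n → ℂ → ℂ) (z : ℂ) : ℂ :=
  (Matrix.of fun i k : Fin n => iteratedDeriv (i : ℕ) (f k) z).det

/-- `W_{j,m}`, the Wronskian of `g_{1,m}, …, g_{m,m}` with `g_{j,m}` left out. -/
def Wminor (m j : ℕ) (z : ℂ) : ℂ :=
  wronskian (fun k : Fin (m - 1) => g m (if (k : ℕ) + 1 < j then (k : ℕ) + 1 else (k : ℕ) + 2)) z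

/-- `G(m+1) = ∏_{j=1}^{m-1} j!`. -/
def barnesG (m : ℕ) : ℂ := ∏ j ∈ Finset.Icc 1 (m - 1), (Nat.factorial j : ℂ)

/-! ### The explicit pre-kernel -/

/-- `(z e^{(1-s²)z²/2} - w e^{(1-s²)w²/2}) F_{1,c}(s z w)` at `z = exp Z`, `w = exp W`. -/
def integrandOne (c : ℝ) (Z W : ℂ) (s : ℝ) : ℂ :=
  (Complex.exp Z * Complex.exp (1 / 2 * (1 - (s : ℂ) ^ 2) * Complex.exp Z ^ 2) -
      Complex.exp W * Complex.exp (1 / 2 * (1 - (s : ℂ) ^ 2) * Complex.exp W ^ 2)) *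
    FML 1 c ((Real.log s : ℂ) + Z + W)

/-- `(z g_{j,m}(z) W_{j,m}(sz) - w g_{j,m}(w) W_{j,m}(sw)) F_{m,c}(s z w)` at `z = exp Z`,
`w = exp W`. -/
def integrand (m : ℕ) (c : ℝ) (j : ℕ) (Z W : ℂ) (s : ℝ) : ℂ :=
  (Complex.exp Z * g m j (Complex.exp Z) * Wminor m j ((s : ℂ) * Complex.exp Z) -
      Complex.exp W * g m j (Complex.exp W) * Wminor m j ((s : ℂ) * Complex.exp W)) *
    FML m c ((Real.log s : ℂ) + Z + W)

/-- The function `κ̃_{1/m,c}(z, w)` at `z = exp Z`, `w = exp W`. -/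
def kappaTilde (m : ℕ) (c : ℝ) (Z W : ℂ) : ℂ :=
  if m = 1 then ∫ s in (0 : ℝ)..1, integrandOne c Z W s
  else ∑ j ∈ Finset.Icc 1 m,
    (-1 : ℂ) ^ (m - j) / barnesG m * ∫ s in (0 : ℝ)..1, integrand m c j Z W s

/-- A logarithm of `√(2/λ) z^λ`, `z = exp Z`. -/
def logScale (lam : ℝ) (Z : ℂ) : ℂ := (Real.log (Real.sqrt (2 / lam)) : ℂ) + (lam : ℂ) * Z

/-- `κ_{λ,c}(z,w) = (2/λ)^{1/(2λ)} (zw)^{λ-1} κ̃_{λ,c}(√(2/λ) z^λ, √(2/λ) w^λ)` with `λ = 1/m`,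
at `z = exp Z`, `w = exp W`. -/
def kappa (m : ℕ) (c : ℝ) (Z W : ℂ) : ℂ :=
  (((2 / (1 / (m : ℝ))) ^ (1 / (2 * (1 / (m : ℝ)))) : ℝ) : ℂ) *
    Complex.exp (((1 / (m : ℝ) - 1 : ℝ) : ℂ) * (Z + W)) *
    kappaTilde m c (logScale (1 / (m : ℝ)) Z) (logScale (1 / (m : ℝ)) W)

end MittagLefflerKernel

end

noncomputable section

namespace MittagLefflerKernel

section

/-! ### Moments of the weight -/

/-! Both sides are computed as one explicit double power series, and the two results agree term by
term.

Finite `N`. The weight is radial, so monomials of different degree are orthogonal, and the moments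
`h_k` are Gamma values. The factor `ζ̄ - ζ` then couples only neighbouring degrees, and the
skew-orthogonality relations are solved by `q_{2k+1} = ζ^{2k+1}`, with `q_{2k}` even and its
coefficients products of moment ratios (`isSkewOrthogonal_skewPoly`). Any other family gives the
same pre-kernel, because its coefficient matrix is minus the inverse of the truncated Gram matrix
(`IsSkewOrthogonal.preKernel_eq`). For the explicit family every power of `N` cancels after
rescaling: `r_N^{2c} κ_N` is a constant times the part `l + p < N` of a double series in
`u^{2l+2p+1} v^{2l} - u^{2l} v^{2l+2p+1}`, where `u = ρz`, `v = ρw`, `ρ = (2m)^{m/2}`, and the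
coefficients do not involve `N` (`microScale_rpow_mul_rescaledPreKernel_skewPoly`). Factorial decay
of the coefficients makes the sum entire and the convergence locally uniform. In the weighted
kernel, `|z|^c` from the weight and the phase `h(z)` combine to `z^c`
(`finiteKernel_eq_limitKernel`).

Explicit kernel. The `g_{j,m}` form a fundamental system of `y^{(m)} = t^m y`. For `m > 1` their
Wronskian is the constant `G(m+1)`, and by Cramer's rule the combination of the `g_{j,m}(x)` with
the minors `W_{j,m}(t)` is an entry of `Φ(x) Φ(t)⁻¹`, `Φ` being the fundamental matrix: a Green
function of the equation. Integrating by parts `m` times turns the equation into a recursion for the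
power moments `J(a) = ∫₀¹ s^a ψ(s) ds` of `x` times this function at `t = sx`: `J(a) =
Γ(a+1)/Γ(a+1+m) · x^m (1 + x^m J(a+2m))` (`greenMoment_last`). For `m = 1` the Gaussian satisfies
the same recursion (`integral_rpow_mul_gaussian`). Iterating it produces the sum over `p`, and
expanding `F_{m,c}(szw)` in powers of `s` produces the sum over `l` (`integral_mul_FML`).
Antisymmetrising gives the double series, and the change of variables `√(2/λ) z^λ` matches the
constants (`kappa_eq`). -/

theorem integral_norm_rpow_mul_exp {p q b : ℝ} (hp : 0 < p) (hq : -2 < q) (hb : 0 < b) :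
    ∫ x : ℂ, ‖x‖ ^ q * Real.exp (-b * ‖x‖ ^ p) = (2 * Real.pi / p) *
      b ^ (-(q + 2) / p) * Real.Gamma ((q + 2) / p) := by
  calc
    _ = ∫ x in Set.Ioi (0 : ℝ) ×ˢ Set.Ioo (-Real.pi) Real.pi,
          x.1 * (|x.1| ^ q * Real.exp (-b * |x.1| ^ p)) := by
      rw [← Complex.integral_comp_polarCoord_symm, polarCoord_target]
      simp_rw [Complex.norm_polarCoord_symm, smul_eq_mul]
    _ = (∫ x in Set.Ioi (0 : ℝ), x * |x| ^ q * Real.exp (-b * |x| ^ p)) *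
          ∫ _ in Set.Ioo (-Real.pi) Real.pi, (1 : ℝ) := by
      rw [← setIntegral_prod_mul, Measure.volume_eq_prod]
      simp_rw [mul_one]
      congr! 2; ring
    _ = 2 * Real.pi * ∫ x in Set.Ioi (0 : ℝ), x * |x| ^ q * Real.exp (-b * |x| ^ p) := by
      simp_rw [integral_const, measureReal_restrict_apply MeasurableSet.univ, Set.univ_inter,
        Real.volume_real_Ioo_of_le (a := -Real.pi) (b := Real.pi) (by linarith [Real.pi_nonneg]),
        sub_neg_eq_add, ← two_mul, smul_eq_mul, mul_one, mul_comm]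
    _ = 2 * Real.pi * ∫ x in Set.Ioi (0 : ℝ), x ^ (q + 1) * Real.exp (-b * x ^ p) := by
      congr 1
      refine setIntegral_congr_fun measurableSet_Ioi (fun x hx => ?_)
      rw [Set.mem_Ioi] at hx
      rw [abs_eq_self.mpr hx.le, Real.rpow_add hx, Real.rpow_one]
      ring
    _ = _ := by
      rw [_root_.integral_rpow_mul_exp_neg_mul_rpow hp (by linarith) hb, add_assoc,
        one_add_one_eq_two]
      ring

/-- `h_k = ∫ |ζ|^{2k} e^{-N Q(ζ)} dA(ζ)`. -/
def moment (m : ℕ) (c : ℝ) (N k : ℕ) : ℝ :=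
  m * Real.Gamma (m * (1 + c) + m * k) * (N : ℝ) ^ (-(m * (1 + c) + m * k))

variable {m : ℕ} {c : ℝ} {N : ℕ}

theorem cast_mul_one_add_pos (hm : 1 ≤ m) (hc : -1 < c) : 0 < (m : ℝ) * (1 + c) := by
  have : (0 : ℝ) < m := by exact_mod_cast hm
  exact mul_pos this (by linarith)

theorem moment_pos (hm : 1 ≤ m) (hc : -1 < c) (hN : 1 ≤ N) (k : ℕ) : 0 < moment m c N k := by
  have h0 := cast_mul_one_add_pos hm hc
  have h1 : (0 : ℝ) < m := by exact_mod_cast hm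
  have h2 : (0 : ℝ) < N := by exact_mod_cast hN
  have h3 : 0 < Real.Gamma (m * (1 + c) + m * k) := Real.Gamma_pos_of_pos (by positivity)
  unfold moment
  positivity

/-- The weight `e^{-N Q}`. -/
def weight (m : ℕ) (c : ℝ) (N : ℕ) (ζ : ℂ) : ℝ :=
  Real.exp (-(N : ℝ) * potential (1 / (m : ℝ)) c N ζ)

theorem weight_nonneg (ζ : ℂ) : 0 ≤ weight m c N ζ := (Real.exp_pos _).le

theorem measurable_weight : Measurable (weight m c N) := by
  unfold weight potential
  fun_prop

theorem weight_of_ne_zero (hN : 1 ≤ N) {ζ : ℂ} (hζ : ζ ≠ 0) :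
    weight m c N ζ = ‖ζ‖ ^ (2 * c) * Real.exp (-(N : ℝ) * ‖ζ‖ ^ (2 * (1 / (m : ℝ)))) := by
  have h2 : (N : ℝ) ≠ 0 := by positivity
  have h3 : 0 < ‖ζ‖ := norm_pos_iff.mpr hζ
  rw [weight, potential, Real.rpow_def_of_pos h3 (2 * c), ← Real.exp_add]
  congr 1
  field_simp
  ring

theorem integral_norm_pow_mul_weight (hm : 1 ≤ m) (hc : -1 < c) (hN : 1 ≤ N) (k : ℕ) :
    ∫ ζ : ℂ, ‖ζ‖ ^ (2 * k) * weight m c N ζ = Real.pi * moment m c N k := by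
  have h1 : (0 : ℝ) < m := by exact_mod_cast hm
  have h2 : (0 : ℝ) < N := by exact_mod_cast hN
  have hk : (0 : ℝ) ≤ k := by positivity
  have : (fun ζ : ℂ => ‖ζ‖ ^ (2 * k) * weight m c N ζ) =ᵐ[volume]
      fun ζ => ‖ζ‖ ^ (2 * (k : ℝ) + 2 * c) * Real.exp (-(N : ℝ) * ‖ζ‖ ^ (2 * (1 / (m : ℝ)))) := by
    -- The origin is discarded: there `Real.log 0 = 0` gives the weight the value `1`, which the
    -- power formula need not reproduce.
    filter_upwards [compl_mem_ae_iff.mpr (measure_singleton (0 : ℂ))] with ζ hζ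
    have hζ : ζ ≠ 0 := hζ
    have h3 : 0 < ‖ζ‖ := norm_pos_iff.mpr hζ
    rw [weight_of_ne_zero hN hζ, Real.rpow_add h3, ← mul_assoc]
    congr 2
    rw [← Real.rpow_natCast]
    push_cast
    rfl
  rw [integral_congr_ae this, integral_norm_rpow_mul_exp (by positivity) (by linarith) h2, moment]
  have e1 : (2 * (k : ℝ) + 2 * c + 2) / (2 * (1 / (m : ℝ))) = m * (1 + c) + m * k := by
    field_simp
    ring
  have e2 : -(2 * (k : ℝ) + 2 * c + 2) / (2 * (1 / (m : ℝ))) = -(m * (1 + c) + m * k) := by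
    rw [← e1]; ring
  rw [e1, e2]
  field_simp

/-- The Bochner integral of a non-integrable function is `0` by convention, whereas the value
already computed is positive; so integrability comes for free. -/
theorem integrable_norm_pow_mul_weight_even (hm : 1 ≤ m) (hc : -1 < c) (hN : 1 ≤ N) (k : ℕ) :
    Integrable fun ζ : ℂ => ‖ζ‖ ^ (2 * k) * weight m c N ζ := by
  by_contra h
  have := integral_norm_pow_mul_weight hm hc hN k
  rw [integral_undef h] at this
  have := mul_pos Real.pi_pos (moment_pos hm hc hN k)
  linarith

theorem integrable_norm_pow_mul_weight (hm : 1 ≤ m) (hc : -1 < c) (hN : 1 ≤ N) (k : ℕ) :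
    Integrable fun ζ : ℂ => ‖ζ‖ ^ k * weight m c N ζ := by
  refine ((integrable_norm_pow_mul_weight_even hm hc hN 0).add
    (integrable_norm_pow_mul_weight_even hm hc hN k)).mono'
    ((by fun_prop : Measurable fun ζ : ℂ => ‖ζ‖ ^ k).mul measurable_weight).aestronglyMeasurable
    (ae_of_all _ fun ζ => ?_)
  have h0 := weight_nonneg (m := m) (c := c) (N := N) ζ
  have : ‖ζ‖ ^ k ≤ 1 + ‖ζ‖ ^ (2 * k) := by
    rw [pow_mul']
    nlinarith [sq_nonneg (‖ζ‖ ^ k - 1), sq_nonneg (‖ζ‖ ^ k)]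
  simp only [Pi.add_apply, mul_zero, pow_zero]
  rw [Real.norm_of_nonneg (by positivity), ← add_mul]
  gcongr

theorem integrable_pow_mul_conj_pow_mul_weight (hm : 1 ≤ m) (hc : -1 < c) (hN : 1 ≤ N)
    (a b : ℕ) :
    Integrable fun ζ : ℂ => ζ ^ a * conj ζ ^ b * (weight m c N ζ : ℂ) := by
  refine (integrable_norm_pow_mul_weight hm hc hN (a + b)).mono' ?_ (ae_of_all _ fun ζ => ?_)
  · have h1 : Measurable fun ζ : ℂ => ζ ^ a * conj ζ ^ b :=
      (Continuous.measurable (by fun_prop))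
    exact (h1.mul (Complex.measurable_ofReal.comp measurable_weight)).aestronglyMeasurable
  · simp [abs_of_nonneg (weight_nonneg ζ), pow_add]

theorem weight_eq_of_norm_eq {ζ η : ℂ} (h : ‖ζ‖ = ‖η‖) : weight m c N ζ = weight m c N η := by
  rw [weight, weight, potential, potential, h]

theorem integral_pow_mul_conj_pow_mul_weight (hm : 1 ≤ m) (hc : -1 < c) (hN : 1 ≤ N)
    (a b : ℕ) :
    ∫ ζ : ℂ, ζ ^ a * conj ζ ^ b * (weight m c N ζ : ℂ) =
      if a = b then ((Real.pi * moment m c N a : ℝ) : ℂ) else 0 := by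
  split_ifs with hab
  · subst hab
    rw [← integral_norm_pow_mul_weight hm hc hN, ← integral_complex_ofReal]
    congr 1 with ζ
    rw [← mul_pow, Complex.mul_conj, Complex.normSq_eq_norm_sq]
    push_cast
    ring
  · set I := ∫ ζ : ℂ, ζ ^ a * conj ζ ^ b * (weight m c N ζ : ℂ) with hI
    -- Rotation by this angle preserves the measure and the weight but multiplies `ζ^a ζ̄^b` by
    -- `e^{iθ(a-b)} = -1`, so the integral equals its own negative.
    let θ : ℝ := Real.pi / ((a : ℝ) - b)
    have hab' : (a : ℝ) - b ≠ 0 := sub_ne_zero.mpr (by exact_mod_cast hab)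
    have key : ∫ ζ : ℂ, (rotation (Circle.exp θ) ζ) ^ a * conj (rotation (Circle.exp θ) ζ) ^ b *
        (weight m c N (rotation (Circle.exp θ) ζ) : ℂ) = I :=
      (rotation (Circle.exp θ)).measurePreserving.integral_comp
        (rotation (Circle.exp θ)).toHomeomorph.measurableEmbedding
        (fun ζ : ℂ => ζ ^ a * conj ζ ^ b * (weight m c N ζ : ℂ))
    have h2 : ∀ ζ : ℂ, (rotation (Circle.exp θ) ζ) ^ a * conj (rotation (Circle.exp θ) ζ) ^ b *
        (weight m c N (rotation (Circle.exp θ) ζ) : ℂ) =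
        -(ζ ^ a * conj ζ ^ b * (weight m c N ζ : ℂ)) := by
      intro ζ
      rw [weight_eq_of_norm_eq (η := ζ) (by simp)]
      have h3 : (Circle.exp θ : ℂ) ^ a * conj (Circle.exp θ : ℂ) ^ b = -1 := by
        rw [Circle.coe_exp, ← Complex.exp_conj, ← Complex.exp_nat_mul, ← Complex.exp_nat_mul,
          ← Complex.exp_add, ← Complex.exp_pi_mul_I]
        congr 1
        have : ((a : ℂ) - b) * θ = Real.pi := by
          have : ((a : ℝ) - b) * θ = Real.pi := by simp only [θ]; field_simp
          exact_mod_cast this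
        simp only [map_mul, Complex.conj_ofReal, Complex.conj_I]
        linear_combination Complex.I * this
      rw [rotation_apply, map_mul, mul_pow, mul_pow]
      linear_combination (ζ ^ a * conj ζ ^ b * (weight m c N ζ : ℂ)) * h3
    simp_rw [h2] at key
    rw [integral_neg, ← hI] at key
    linear_combination (-1 / 2 : ℂ) * key

end

section

/-! ### The skew product of polynomials -/

variable {m : ℕ} {c : ℝ} {N : ℕ}

/-- The Gram matrix of the monomials for the skew product. -/
def gram (m : ℕ) (c : ℝ) (N a b : ℕ) : ℝ :=
  (if a = b + 1 then 2 * moment m c N a else 0) - (if b = a + 1 then 2 * moment m c N b else 0)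

theorem skewProduct_polyFun (hm : 1 ≤ m) (hc : -1 < c) (hN : 1 ≤ N) {p q : Polynomial ℝ} {n : ℕ}
    (hp : p.natDegree < n) (hq : q.natDegree < n) :
    skewProduct N (potential (1 / (m : ℝ)) c N) (polyFun p) (polyFun q) =
      ∑ a ∈ Finset.range n, ∑ b ∈ Finset.range n,
        (p.coeff a : ℂ) * (gram m c N a b : ℂ) * (q.coeff b : ℂ) := by
  let T : ℕ → ℕ → ℂ → ℂ := fun a b ζ => ζ ^ a * conj ζ ^ b * (weight m c N ζ : ℂ)
  have hT : ∀ a b, Integrable (T a b) := integrable_pow_mul_conj_pow_mul_weight hm hc hN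
  have hpf : ∀ ζ, polyFun p ζ = ∑ a ∈ Finset.range n, (p.coeff a : ℂ) * ζ ^ a := fun ζ => by
    rw [polyFun, Polynomial.aeval_eq_sum_range' hp]
    simp
  have hqf : ∀ ζ, polyFun q ζ = ∑ a ∈ Finset.range n, (q.coeff a : ℂ) * ζ ^ a := fun ζ => by
    rw [polyFun, Polynomial.aeval_eq_sum_range' hq]
    simp
  have hint : ∀ ζ, (conj ζ - ζ) * (Real.exp (-(N : ℝ) * potential (1 / (m : ℝ)) c N ζ) : ℂ) *
      (polyFun p ζ * conj (polyFun q ζ) - conj (polyFun p ζ) * polyFun q ζ) =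
      ∑ a ∈ Finset.range n, ∑ b ∈ Finset.range n, (p.coeff a : ℂ) * (q.coeff b : ℂ) *
        (T a (b + 1) ζ - T b (a + 1) ζ - T (a + 1) b ζ + T (b + 1) a ζ) := by
    intro ζ
    rw [hpf, hqf]
    simp only [map_sum, map_mul, map_pow, Complex.conj_ofReal]
    rw [Finset.sum_mul_sum, Finset.sum_mul_sum]
    simp only [← Finset.sum_sub_distrib, Finset.mul_sum]
    refine Finset.sum_congr rfl fun a _ => Finset.sum_congr rfl fun b _ => ?_
    simp only [T, weight]
    ring
  have hI : ∀ a b, Integrable fun ζ => (p.coeff a : ℂ) * (q.coeff b : ℂ) *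
        (T a (b + 1) ζ - T b (a + 1) ζ - T (a + 1) b ζ + T (b + 1) a ζ) := fun a b =>
    ((((hT _ _).sub (hT _ _)).sub (hT _ _)).add (hT _ _)).const_mul _
  rw [skewProduct]
  simp_rw [hint]
  rw [integral_finsetSum _ fun a _ => integrable_finsetSum _ fun b _ => hI a b, Finset.mul_sum]
  refine Finset.sum_congr rfl fun a _ => ?_
  rw [integral_finsetSum _ fun b _ => hI a b, Finset.mul_sum]
  refine Finset.sum_congr rfl fun b _ => ?_
  have hTi : ∀ a b, ∫ ζ, T a b ζ = if a = b then ((Real.pi * moment m c N a : ℝ) : ℂ) else 0 :=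
    integral_pow_mul_conj_pow_mul_weight hm hc hN
  have e : ∫ ζ, (p.coeff a : ℂ) * (q.coeff b : ℂ) *
      (T a (b + 1) ζ - T b (a + 1) ζ - T (a + 1) b ζ + T (b + 1) a ζ) =
      (p.coeff a : ℂ) * (q.coeff b : ℂ) * ((∫ ζ, T a (b + 1) ζ) - (∫ ζ, T b (a + 1) ζ) -
        (∫ ζ, T (a + 1) b ζ) + ∫ ζ, T (b + 1) a ζ) := by
    rw [integral_const_mul]
    congr 1
    have i1 := integral_add (((hT a (b + 1)).sub (hT b (a + 1))).sub (hT (a + 1) b)) (hT (b + 1) a)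
    have i2 := integral_sub ((hT a (b + 1)).sub (hT b (a + 1))) (hT (a + 1) b)
    have i3 := integral_sub (hT a (b + 1)) (hT b (a + 1))
    simp only [Pi.sub_apply] at i1 i2 i3
    rw [i1, i2, i3]
  rw [e]
  simp only [hTi, gram]
  have hpi : (Real.pi : ℂ) ≠ 0 := by exact_mod_cast Real.pi_ne_zero
  by_cases h1 : a = b + 1
  · subst h1
    simp [show ¬b = b + 1 + 1 by omega, show ¬b + 1 + 1 = b by omega]
    field_simp
    ring
  · by_cases h2 : b = a + 1
    · subst h2
      simp [show ¬a = a + 1 + 1 by omega, show ¬a + 1 + 1 = a by omega]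
      field_simp
      ring
    · simp [h1, h2, Ne.symm h1, Ne.symm h2]

/-- The Gram matrix lives on the two off-diagonals, so the double sum collapses to a single one. The
degree bounds make the extra coefficients at index `n` vanish. -/
theorem skewProduct_polyFun_eq_sum (hm : 1 ≤ m) (hc : -1 < c) (hN : 1 ≤ N) {p q : Polynomial ℝ}
    {n : ℕ} (hp : p.natDegree < n) (hq : q.natDegree < n) :
    skewProduct N (potential (1 / (m : ℝ)) c N) (polyFun p) (polyFun q) =
      ((∑ a ∈ Finset.range n, 2 * moment m c N (a + 1) *
        (p.coeff (a + 1) * q.coeff a - p.coeff a * q.coeff (a + 1)) : ℝ) : ℂ) := by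
  rw [skewProduct_polyFun hm hc hN hp hq]
  norm_cast
  simp only [gram, mul_sub, sub_mul, Finset.sum_sub_distrib]
  congr 1
  · rw [Finset.sum_comm]
    refine Finset.sum_congr rfl fun b _ => ?_
    simp only [mul_ite, ite_mul, mul_zero, zero_mul, Finset.sum_ite_eq', Finset.mem_range]
    split_ifs with h
    · ring
    · rw [Polynomial.coeff_eq_zero_of_natDegree_lt (by omega : p.natDegree < b + 1)]
      ring
  · refine Finset.sum_congr rfl fun a _ => ?_
    simp only [mul_ite, ite_mul, mul_zero, zero_mul, Finset.sum_ite_eq', Finset.mem_range]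
    split_ifs with h
    · ring
    · rw [Polynomial.coeff_eq_zero_of_natDegree_lt (by omega : q.natDegree < a + 1)]
      ring

/-! ### The pre-kernel does not depend on the skew-orthogonal polynomials -/

/-- The degree `2k + e` of the basis element with index `(e, k)`. -/
def pairDegree (i : Fin 2 × Fin N) : ℕ := 2 * i.2 + i.1

theorem sum_pairDegree {M : Type*} [AddCommMonoid M] (f : ℕ → M) :
    ∑ i : Fin 2 × Fin N, f (pairDegree i) = ∑ a ∈ Finset.range (2 * N), f a := by
  rw [Fintype.sum_prod_type_right, ← Fin.sum_univ_eq_sum_range f]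
  simp only [Fin.sum_univ_two, pairDegree]
  rw [Fin.sum_univ_eq_sum_range (fun k => f (2 * k + (0 : Fin 2)) + f (2 * k + (1 : Fin 2))) N,
    Fin.sum_univ_eq_sum_range f]
  induction N with
  | zero => simp
  | succ n ih =>
    rw [Finset.sum_range_succ, ih, mul_add, Finset.sum_range_succ, Finset.sum_range_succ, add_assoc]
    simp

/-- The matrix of coefficients of `q_0, …, q_{2N-1}`. -/
def coeffMatrix (N : ℕ) (q : ℕ → Polynomial ℝ) : Matrix (Fin 2 × Fin N) (Fin 2 × Fin N) ℂ :=
  Matrix.of fun i j => (((q (pairDegree i)).coeff (pairDegree j) : ℝ) : ℂ)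

/-- The coefficients of the pre-kernel with respect to `q_0, …, q_{2N-1}`. -/
def invSkewNormMatrix (N : ℕ) (s : ℕ → ℝ) : Matrix (Fin 2 × Fin N) (Fin 2 × Fin N) ℂ :=
  Matrix.blockDiagonal fun k : Fin N => !![0, -(1 / (s k : ℂ)); 1 / (s k : ℂ), 0]

theorem preKernel_eq_dotProduct {q : ℕ → Polynomial ℝ} {s : ℕ → ℝ}
    (hq : ∀ k, (q k).natDegree = k) (ζ η : ℂ) :
    preKernel N q s ζ η = (fun i : Fin 2 × Fin N => ζ ^ pairDegree i) ⬝ᵥ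
      (((coeffMatrix N q).transpose * invSkewNormMatrix N s * coeffMatrix N q).mulVec
        fun i => η ^ pairDegree i) := by
  have hval : ∀ ζ : ℂ, (coeffMatrix N q).mulVec (fun i => ζ ^ pairDegree i) =
      fun i => polyFun (q (pairDegree i)) ζ := by
    intro ζ
    ext i
    have hi : (q (pairDegree i)).natDegree < 2 * N := by
      rw [hq, pairDegree]
      omega
    rw [polyFun, Polynomial.aeval_eq_sum_range' hi]
    simp only [Matrix.mulVec, dotProduct, coeffMatrix, Matrix.of_apply]
    rw [sum_pairDegree fun a => (((q (pairDegree i)).coeff a : ℝ) : ℂ) * ζ ^ a]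
    simp
  rw [← Matrix.mulVec_mulVec, ← Matrix.mulVec_mulVec, Matrix.dotProduct_mulVec,
    Matrix.vecMul_transpose, hval, hval, preKernel, ← Fin.sum_univ_eq_sum_range (fun k =>
      (polyFun (q (2 * k + 1)) ζ * polyFun (q (2 * k)) η -
        polyFun (q (2 * k)) ζ * polyFun (q (2 * k + 1)) η) / (s k : ℂ))]
  simp only [dotProduct, Matrix.mulVec, invSkewNormMatrix, Fintype.sum_prod_type_right,
    Fin.sum_univ_two, Matrix.blockDiagonal_apply]
  refine Finset.sum_congr rfl fun k _ => ?_
  simp [pairDegree]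
  ring

theorem IsSkewOrthogonal.natDegree_eq {Q : ℂ → ℝ} {q : ℕ → Polynomial ℝ} {s : ℕ → ℝ}
    (h : IsSkewOrthogonal N Q q s) (k : ℕ) : (q k).natDegree = k :=
  Polynomial.natDegree_eq_of_degree_eq_some (h.degree_eq k)

/-- Skew-orthogonality reads `A G Aᵀ = J`, with `A` the coefficients, `G` the Gram matrix and `J`
block diagonal. With `B` the matrix of inverse skew-norms, `B J = -1`, so `(-B A G) Aᵀ = 1`; for
square matrices the factors commute, hence `-(Aᵀ B A) G = 1`. -/
theorem IsSkewOrthogonal.neg_mul_gram (hm : 1 ≤ m) (hc : -1 < c) (hN : 1 ≤ N)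
    {q : ℕ → Polynomial ℝ} {s : ℕ → ℝ}
    (h : IsSkewOrthogonal N (potential (1 / (m : ℝ)) c N) q s) :
    (-((coeffMatrix N q).transpose * invSkewNormMatrix N s * coeffMatrix N q)) *
      (Matrix.of fun i j : Fin 2 × Fin N => (gram m c N (pairDegree i) (pairDegree j) : ℂ)) = 1 := by
  set A := coeffMatrix N q
  set G : Matrix (Fin 2 × Fin N) (Fin 2 × Fin N) ℂ :=
    Matrix.of fun i j : Fin 2 × Fin N => (gram m c N (pairDegree i) (pairDegree j) : ℂ)
  have hJ : A * G * A.transpose =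
      Matrix.blockDiagonal fun k : Fin N => !![0, -(s k : ℂ); (s k : ℂ), 0] := by
    ext i j
    have hi : (q (pairDegree i)).natDegree < 2 * N := by
      rw [h.natDegree_eq, pairDegree]; omega
    have hj : (q (pairDegree j)).natDegree < 2 * N := by
      rw [h.natDegree_eq, pairDegree]; omega
    have e : (A * G * A.transpose) i j = skewProduct N (potential (1 / (m : ℝ)) c N)
        (polyFun (q (pairDegree i))) (polyFun (q (pairDegree j))) := by
      rw [skewProduct_polyFun hm hc hN hi hj, Finset.sum_comm, ← sum_pairDegree]
      simp only [Matrix.mul_apply, Matrix.transpose_apply, Finset.sum_mul]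
      refine Finset.sum_congr rfl fun b _ => ?_
      rw [← sum_pairDegree]
      rfl
    rw [e]
    clear e hi hj
    obtain ⟨u, k⟩ := i
    obtain ⟨v, l⟩ := j
    rw [Matrix.blockDiagonal_apply]
    simp only [pairDegree]
    rcases Fin.exists_fin_two.mp ⟨u, rfl⟩ with rfl | rfl <;>
      rcases Fin.exists_fin_two.mp ⟨v, rfl⟩ with rfl | rfl
    · exact (h.even_even k l).trans (by simp)
    · exact (h.even_odd l k).trans (by
        rcases eq_or_ne k l with rfl | hkl
        · simp
        · simp [Fin.val_inj, hkl, hkl.symm])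
    · exact (h.odd_even k l).trans (by simp [Fin.val_inj])
    · exact (h.odd_odd k l).trans (by simp)
  have hinv : invSkewNormMatrix N s * (A * G * A.transpose) = -1 := by
    rw [hJ, invSkewNormMatrix, ← Matrix.blockDiagonal_mul, ← Matrix.blockDiagonal_one,
      ← Matrix.blockDiagonal_neg]
    congr 1
    ext k i j
    have : (s k : ℂ) ≠ 0 := by exact_mod_cast (h.norm_pos k).ne'
    fin_cases i <;> fin_cases j <;> simp [this]
  have h1 : (-(invSkewNormMatrix N s * A * G)) * A.transpose = 1 := by
    rw [Matrix.neg_mul, Matrix.mul_assoc, Matrix.mul_assoc, ← Matrix.mul_assoc A, hinv, neg_neg]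
  have h2 := mul_eq_one_comm.mp h1
  rw [← h2]
  simp only [Matrix.neg_mul, Matrix.mul_neg, Matrix.mul_assoc]

/-- Both coefficient matrices are minus the inverse of the same Gram matrix, and inverses are
unique. The limit therefore needs to be computed for one family only. -/
theorem IsSkewOrthogonal.preKernel_eq (hm : 1 ≤ m) (hc : -1 < c) (hN : 1 ≤ N)
    {q q' : ℕ → Polynomial ℝ} {s s' : ℕ → ℝ}
    (h : IsSkewOrthogonal N (potential (1 / (m : ℝ)) c N) q s)
    (h' : IsSkewOrthogonal N (potential (1 / (m : ℝ)) c N) q' s') (ζ η : ℂ) :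
    preKernel N q s ζ η = preKernel N q' s' ζ η := by
  rw [preKernel_eq_dotProduct h.natDegree_eq, preKernel_eq_dotProduct h'.natDegree_eq]
  have := left_inv_eq_right_inv (h.neg_mul_gram hm hc hN)
    (mul_eq_one_comm.mp (h'.neg_mul_gram hm hc hN))
  rw [neg_inj.mp this]

/-! ### Existence -/

/-- The coefficient of `ζ^{2l}` in the skew-orthogonal polynomial of degree `2k`. -/
def evenCoeff (m : ℕ) (c : ℝ) (N k l : ℕ) : ℝ :=
  ∏ i ∈ Finset.range (k - l), moment m c N (2 * (l + i) + 2) / moment m c N (2 * (l + i) + 1)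

/-- Skew-orthogonal polynomials: `ζ^{2k+1}` in odd degrees, even polynomials in even degrees. -/
def skewPoly (m : ℕ) (c : ℝ) (N n : ℕ) : Polynomial ℝ :=
  if n % 2 = 1 then Polynomial.X ^ n
  else ∑ l ∈ Finset.range (n / 2 + 1), Polynomial.C (evenCoeff m c N (n / 2) l) *
    Polynomial.X ^ (2 * l)

theorem skewPoly_odd (k : ℕ) : skewPoly m c N (2 * k + 1) = Polynomial.X ^ (2 * k + 1) := by
  rw [skewPoly, if_pos (by omega)]

theorem skewPoly_even (k : ℕ) : skewPoly m c N (2 * k) =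
    ∑ l ∈ Finset.range (k + 1), Polynomial.C (evenCoeff m c N k l) * Polynomial.X ^ (2 * l) := by
  rw [skewPoly, if_neg (by omega), Nat.mul_div_cancel_left _ two_pos]

theorem coeff_skewPoly_odd (k a : ℕ) :
    (skewPoly m c N (2 * k + 1)).coeff a = if a = 2 * k + 1 then 1 else 0 := by
  rw [skewPoly_odd, Polynomial.coeff_X_pow]

theorem coeff_skewPoly_even_odd (k a : ℕ) : (skewPoly m c N (2 * k)).coeff (2 * a + 1) = 0 := by
  rw [skewPoly_even, Polynomial.finsetSum_coeff]
  refine Finset.sum_eq_zero fun l _ => ?_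
  rw [Polynomial.coeff_C_mul_X_pow, if_neg (by omega)]

theorem coeff_skewPoly_even_even (k a : ℕ) :
    (skewPoly m c N (2 * k)).coeff (2 * a) = if a ≤ k then evenCoeff m c N k a else 0 := by
  rw [skewPoly_even, Polynomial.finsetSum_coeff]
  simp only [Polynomial.coeff_C_mul_X_pow, mul_right_inj' (two_ne_zero' ℕ)]
  simp [Finset.sum_ite_eq]

theorem degree_skewPoly (n : ℕ) : (skewPoly m c N n).degree = n := by
  obtain ⟨k, rfl | rfl⟩ := Nat.even_or_odd' n
  · have h1 : (skewPoly m c N (2 * k)).coeff (2 * k) ≠ 0 := by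
      rw [coeff_skewPoly_even_even]; simp [evenCoeff]
    refine le_antisymm ?_ (Polynomial.le_degree_of_ne_zero h1)
    rw [skewPoly_even]
    refine (Polynomial.degree_sum_le _ _).trans (Finset.sup_le fun l hl => ?_)
    refine (Polynomial.degree_C_mul_X_pow_le _ _).trans ?_
    have := Finset.mem_range.mp hl
    exact_mod_cast (by omega : 2 * l ≤ 2 * k)
  · rw [skewPoly_odd, Polynomial.degree_X_pow]

theorem natDegree_skewPoly (n : ℕ) : (skewPoly m c N n).natDegree = n :=
  Polynomial.natDegree_eq_of_degree_eq_some (degree_skewPoly n)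

theorem skewProduct_swap (Q : ℂ → ℝ) (h g : ℂ → ℂ) :
    skewProduct N Q h g = -skewProduct N Q g h := by
  rw [skewProduct, skewProduct, ← mul_neg, ← integral_neg]
  congr 2 with ζ
  ring

/-- Pairing with `ζ^{2k+1}` sees only the coefficients at `2k` and `2k+2`. The coefficients of the
even polynomial are chosen so that these two contributions cancel for `k < l`; for `k = l` the
second is absent, for `k > l` both are. -/
theorem skewProduct_skewPoly_odd_even (hm : 1 ≤ m) (hc : -1 < c) (hN : 1 ≤ N) (k l : ℕ) :
    skewProduct N (potential (1 / (m : ℝ)) c N) (polyFun (skewPoly m c N (2 * k + 1)))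
      (polyFun (skewPoly m c N (2 * l))) =
      if k = l then ((2 * moment m c N (2 * k + 1) : ℝ) : ℂ) else 0 := by
  rw [skewProduct_polyFun_eq_sum hm hc hN (n := 2 * k + 2 + 2 * l)
    (by rw [natDegree_skewPoly]; omega) (by rw [natDegree_skewPoly]; omega)]
  have : ∀ a, 2 * moment m c N (a + 1) *
      ((skewPoly m c N (2 * k + 1)).coeff (a + 1) * (skewPoly m c N (2 * l)).coeff a -
        (skewPoly m c N (2 * k + 1)).coeff a * (skewPoly m c N (2 * l)).coeff (a + 1)) =
      (if a = 2 * k then 2 * moment m c N (a + 1) * (skewPoly m c N (2 * l)).coeff a else 0) -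
      (if a = 2 * k + 1 then 2 * moment m c N (a + 1) * (skewPoly m c N (2 * l)).coeff (a + 1)
        else 0) := by
    intro a
    simp only [coeff_skewPoly_odd, Nat.add_right_cancel_iff]
    split_ifs <;> ring
  simp only [this, Finset.sum_sub_distrib, Finset.sum_ite_eq', Finset.mem_range]
  rw [if_pos (by omega), if_pos (by omega), coeff_skewPoly_even_even,
    show 2 * k + 1 + 1 = 2 * (k + 1) by ring, coeff_skewPoly_even_even]
  have hpos := moment_pos (m := m) (c := c) (N := N) hm hc hN
  rcases lt_trichotomy k l with h | h | h
  · rw [if_pos h.le, if_pos (Nat.succ_le_of_lt h), if_neg h.ne]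
    have : evenCoeff m c N l k = moment m c N (2 * k + 2) / moment m c N (2 * k + 1) *
        evenCoeff m c N l (k + 1) := by
      rw [evenCoeff, evenCoeff, show l - k = l - (k + 1) + 1 by omega, Finset.prod_range_succ',
        mul_comm]
      congr 1
      refine Finset.prod_congr rfl fun i _ => ?_
      rw [show k + (i + 1) = k + 1 + i by ring]
    rw [this, show 2 * (k + 1) = 2 * k + 2 by ring]
    have := (hpos (2 * k + 1)).ne'
    norm_cast
    field_simp
    ring
  · subst h
    simp [evenCoeff]
  · rw [if_neg (by omega), if_neg (by omega), if_neg (by omega)]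
    simp

theorem isSkewOrthogonal_skewPoly (hm : 1 ≤ m) (hc : -1 < c) (hN : 1 ≤ N) :
    IsSkewOrthogonal N (potential (1 / (m : ℝ)) c N) (skewPoly m c N)
      (fun k => 2 * moment m c N (2 * k + 1)) where
  degree_eq := degree_skewPoly
  norm_pos k := mul_pos two_pos (moment_pos hm hc hN _)
  odd_even k l := skewProduct_skewPoly_odd_even hm hc hN k l
  even_odd k l := by
    rw [skewProduct_swap, skewProduct_skewPoly_odd_even hm hc hN]
    split_ifs <;> simp
  odd_odd k l := by
    rw [skewProduct_polyFun_eq_sum hm hc hN (n := 2 * k + 2 + 2 * l)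
      (by rw [natDegree_skewPoly]; omega) (by rw [natDegree_skewPoly]; omega)]
    rw [Finset.sum_eq_zero, Complex.ofReal_zero]
    intro a _
    simp only [coeff_skewPoly_odd]
    split_ifs <;> first | omega | simp
  even_even k l := by
    rw [skewProduct_polyFun_eq_sum hm hc hN (n := 2 * k + 2 + 2 * l)
      (by rw [natDegree_skewPoly]; omega) (by rw [natDegree_skewPoly]; omega)]
    rw [Finset.sum_eq_zero, Complex.ofReal_zero]
    intro a _
    obtain ⟨b, rfl | rfl⟩ := Nat.even_or_odd' a
    · simp [coeff_skewPoly_even_odd]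
    · simp [coeff_skewPoly_even_odd]

end

section

/-! ### Quotients of Gamma functions -/

/-- `Γ(x) / Γ(x + m)`. -/
def gammaRatio (m : ℕ) (x : ℝ) : ℝ := Real.Gamma x / Real.Gamma (x + m)

theorem gammaRatio_pos (m : ℕ) {x : ℝ} (hx : 0 < x) : 0 < gammaRatio m x :=
  div_pos (Real.Gamma_pos_of_pos hx) (Real.Gamma_pos_of_pos (by positivity))

theorem Gamma_add_natCast (n : ℕ) {x : ℝ} (hx : 0 < x) :
    Real.Gamma (x + n) = Real.Gamma x * ∏ i ∈ Finset.range n, (x + i) := by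
  induction n with
  | zero => simp
  | succ n ih =>
    rw [Finset.prod_range_succ, ← mul_assoc, ← ih, Nat.cast_succ, ← add_assoc,
      Real.Gamma_add_one (by positivity), mul_comm]

theorem gammaRatio_eq_inv_prod (m : ℕ) {x : ℝ} (hx : 0 < x) :
    gammaRatio m x = (∏ i ∈ Finset.range m, (x + i))⁻¹ := by
  have := (Real.Gamma_pos_of_pos hx).ne'
  rw [gammaRatio, Gamma_add_natCast m hx]
  field_simp

theorem mul_Gamma_le_Gamma_add {m : ℕ} (hm : 1 ≤ m) {x : ℝ} (hx : 0 < x) :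
    x * Real.Gamma x ≤ Real.Gamma (x + m) := by
  obtain ⟨n, rfl⟩ := Nat.exists_eq_add_of_le' hm
  rw [Gamma_add_natCast _ hx, Finset.prod_range_succ', Nat.cast_zero, add_zero]
  have h1 : 1 ≤ ∏ k ∈ Finset.range n, (x + ((k + 1 : ℕ) : ℝ)) :=
    Finset.one_le_prod fun i _ => by push_cast; linarith [(Nat.cast_nonneg i : (0 : ℝ) ≤ i)]
  nlinarith [mul_pos hx (Real.Gamma_pos_of_pos hx)]

theorem gammaRatio_le {m : ℕ} (hm : 1 ≤ m) {x : ℝ} (hx : 0 < x) : gammaRatio m x ≤ 1 / x := by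
  rw [gammaRatio, div_le_div_iff₀ (Real.Gamma_pos_of_pos (by positivity)) hx, one_mul, mul_comm]
  exact mul_Gamma_le_Gamma_add hm hx

/-- Bounds each factor of a Gamma quotient below by a multiple of `k + 1`, which is how factorials
enter all later convergence estimates. -/
theorem min_one_mul_le_add (b : ℝ) {M : ℕ} (hM : 1 ≤ M) (k : ℕ) :
    min b 1 * (k + 1) ≤ b + M * k := by
  have h1 : (1 : ℝ) ≤ M := by exact_mod_cast hM
  have h2 : (0 : ℝ) ≤ k := k.cast_nonneg
  have h3 : min b 1 * k ≤ 1 * k := by gcongr; exact min_le_right _ _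
  nlinarith [min_le_left b 1]

theorem Gamma_add_mul_ge {b : ℝ} (hb : 0 < b) {M : ℕ} (hM : 1 ≤ M) (k : ℕ) :
    Real.Gamma b * min b 1 ^ k * k.factorial ≤ Real.Gamma (b + M * k) := by
  have hδ : 0 < min b 1 := lt_min hb one_pos
  induction k with
  | zero => simp
  | succ k ih =>
    have h0 : 0 < b + M * k := by positivity
    have h1 := mul_Gamma_le_Gamma_add hM h0
    have h2 := min_one_mul_le_add b hM k
    have h3 := Real.Gamma_pos_of_pos hb
    calc Real.Gamma b * min b 1 ^ (k + 1) * (k + 1).factorial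
        = (min b 1 * (k + 1)) * (Real.Gamma b * min b 1 ^ k * k.factorial) := by
          rw [Nat.factorial_succ]; push_cast; ring
      _ ≤ (b + M * k) * Real.Gamma (b + M * k) := by gcongr
      _ ≤ Real.Gamma (b + M * (k + 1 : ℕ)) := by
          convert h1 using 2
          push_cast
          ring

theorem inv_Gamma_add_mul_le {b : ℝ} (hb : 0 < b) {M : ℕ} (hM : 1 ≤ M) (k : ℕ) :
    (Real.Gamma (b + M * k))⁻¹ ≤ (Real.Gamma b)⁻¹ * ((min b 1)⁻¹ ^ k / k.factorial) := by
  have hδ : 0 < min b 1 := lt_min hb one_pos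
  have h3 := Real.Gamma_pos_of_pos hb
  refine (inv_anti₀ (by positivity) (Gamma_add_mul_ge hb hM k)).trans_eq ?_
  rw [inv_pow]
  field_simp

/-! ### The double series -/

/-- The coefficient `1/Γ(b+2ml) ∏_{i ≤ p} Γ(b+2m(l+i)) / Γ(b+2m(l+i)+m)`. -/
def seriesCoeff (m : ℕ) (b : ℝ) (l p : ℕ) : ℝ :=
  (Real.Gamma (b + (2 * m : ℕ) * l))⁻¹ *
    ∏ i ∈ Finset.range (p + 1), gammaRatio m (b + (2 * m : ℕ) * (l + i : ℕ))

variable {m : ℕ} {b : ℝ}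

theorem seriesCoeff_pos (hb : 0 < b) (l p : ℕ) : 0 < seriesCoeff m b l p := by
  refine mul_pos (inv_pos.mpr (Real.Gamma_pos_of_pos (by positivity)))
    (Finset.prod_pos fun i _ => gammaRatio_pos _ (by positivity))

theorem prod_gammaRatio_le (hm : 1 ≤ m) (hb : 0 < b) (l p : ℕ) :
    ∏ i ∈ Finset.range p, gammaRatio m (b + (2 * m : ℕ) * (l + i : ℕ)) ≤
      (min b 1)⁻¹ ^ p / p.factorial := by
  have hδ : 0 < min b 1 := lt_min hb one_pos
  calc _ ≤ ∏ i ∈ Finset.range p, (min b 1)⁻¹ * ((i : ℝ) + 1)⁻¹ := by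
        refine Finset.prod_le_prod (fun i _ => (gammaRatio_pos _ (by positivity)).le) fun i _ => ?_
        refine (gammaRatio_le hm (by positivity)).trans ?_
        rw [← mul_inv, one_div]
        refine inv_anti₀ (by positivity)
          ((min_one_mul_le_add b (by omega : 1 ≤ 2 * m) i).trans ?_)
        push_cast
        have : (0 : ℝ) ≤ l := l.cast_nonneg
        nlinarith [mul_nonneg (Nat.cast_nonneg m : (0 : ℝ) ≤ m) this]
    _ = _ := by
        rw [Finset.prod_mul_distrib, Finset.prod_const, Finset.card_range, div_eq_mul_inv,
          Finset.prod_inv_distrib, ← Finset.prod_range_add_one_eq_factorial]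
        push_cast
        rfl

/-- The reciprocal Gamma supplies the decay in `l` and the product of ratios the decay in `p`. The
bound factorises, so the double series is dominated by a product of two exponential series. -/
theorem seriesCoeff_le (hm : 1 ≤ m) (hb : 0 < b) (l p : ℕ) :
    seriesCoeff m b l p ≤ ((Real.Gamma b)⁻¹ * (min b 1)⁻¹) *
      (((min b 1)⁻¹ ^ l / l.factorial) * ((min b 1)⁻¹ ^ p / p.factorial)) := by
  have hδ : 0 < min b 1 := lt_min hb one_pos
  have h3 := Real.Gamma_pos_of_pos hb
  have h4 : (min b 1)⁻¹ ^ (p + 1) / (p + 1).factorial ≤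
      (min b 1)⁻¹ * ((min b 1)⁻¹ ^ p / p.factorial) := by
    rw [pow_succ', mul_div_assoc]
    gcongr
    omega
  calc seriesCoeff m b l p ≤ ((Real.Gamma b)⁻¹ * ((min b 1)⁻¹ ^ l / l.factorial)) *
        ((min b 1)⁻¹ * ((min b 1)⁻¹ ^ p / p.factorial)) := by
        refine mul_le_mul (inv_Gamma_add_mul_le hb (by omega) l)
          ((prod_gammaRatio_le hm hb l (p + 1)).trans h4)
          (Finset.prod_nonneg fun i _ => (gammaRatio_pos _ (by positivity)).le) (by positivity)
    _ = _ := by ring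

/-- The term `(l, p)` of the double series. -/
def seriesTerm (m : ℕ) (b : ℝ) (i : ℕ × ℕ) (x : ℂ × ℂ) : ℂ :=
  (seriesCoeff m b i.1 i.2 : ℂ) *
    (x.1 ^ (2 * i.1 + 2 * i.2 + 1) * x.2 ^ (2 * i.1) -
      x.1 ^ (2 * i.1) * x.2 ^ (2 * i.1 + 2 * i.2 + 1))

/-- The double series. -/
def series (m : ℕ) (b : ℝ) (x : ℂ × ℂ) : ℂ := ∑' i, seriesTerm m b i x

theorem summable_mul_seriesCoeff (hm : 1 ≤ m) (hb : 0 < b) {A B : ℝ} (hA : 0 ≤ A) (hB : 0 ≤ B) :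
    Summable fun i : ℕ × ℕ => seriesCoeff m b i.1 i.2 * (A ^ i.1 * B ^ i.2) := by
  have hδ : 0 < min b 1 := lt_min hb one_pos
  have h3 := Real.Gamma_pos_of_pos hb
  have h := ((Real.summable_pow_div_factorial ((min b 1)⁻¹ * A)).mul_of_nonneg
    (Real.summable_pow_div_factorial ((min b 1)⁻¹ * B)) (fun _ => by positivity)
    (fun _ => by positivity)).mul_left ((Real.Gamma b)⁻¹ * (min b 1)⁻¹)
  refine h.of_nonneg_of_le
    (fun i => mul_nonneg (seriesCoeff_pos hb _ _).le (by positivity)) fun i => ?_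
  refine (mul_le_mul_of_nonneg_right (seriesCoeff_le hm hb i.1 i.2) (by positivity)).trans_eq ?_
  simp only [mul_pow]
  ring

theorem summable_seriesCoeff_mul_pow (hm : 1 ≤ m) (hb : 0 < b) {R : ℝ} (hR : 0 ≤ R) (C : ℝ) :
    Summable fun i : ℕ × ℕ => seriesCoeff m b i.1 i.2 * (C * R ^ (4 * i.1 + 2 * i.2 + 1)) := by
  refine ((summable_mul_seriesCoeff hm hb (pow_nonneg hR 4) (pow_nonneg hR 2)).mul_left
    (C * R)).congr fun i => ?_
  rw [← pow_mul, ← pow_mul]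
  ring

theorem norm_pow_mul_pow_le {R : ℝ} {z w : ℂ} (hz : ‖z‖ ≤ R) (hw : ‖w‖ ≤ R) (a b : ℕ) :
    ‖z ^ a * w ^ b‖ ≤ R ^ (a + b) := by
  rw [norm_mul, norm_pow, norm_pow, pow_add]
  have := norm_nonneg z
  have : 0 ≤ R := (norm_nonneg z).trans hz
  gcongr

theorem norm_seriesTerm_le (hb : 0 < b) {R : ℝ} {x : ℂ × ℂ} (hx : ‖x‖ ≤ R) (i : ℕ × ℕ) :
    ‖seriesTerm m b i x‖ ≤ seriesCoeff m b i.1 i.2 * (2 * R ^ (4 * i.1 + 2 * i.2 + 1)) := by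
  have h1 := (norm_fst_le x).trans hx
  have h2 := (norm_snd_le x).trans hx
  rw [seriesTerm, norm_mul, Complex.norm_real, Real.norm_of_nonneg (seriesCoeff_pos hb _ _).le]
  refine mul_le_mul_of_nonneg_left ((norm_sub_le _ _).trans ?_) (seriesCoeff_pos hb _ _).le
  have e1 := norm_pow_mul_pow_le h1 h2 (2 * i.1 + 2 * i.2 + 1) (2 * i.1)
  have e2 := norm_pow_mul_pow_le h1 h2 (2 * i.1) (2 * i.1 + 2 * i.2 + 1)
  rw [show 2 * i.1 + 2 * i.2 + 1 + 2 * i.1 = 4 * i.1 + 2 * i.2 + 1 by ring] at e1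
  rw [show 2 * i.1 + (2 * i.1 + 2 * i.2 + 1) = 4 * i.1 + 2 * i.2 + 1 by ring] at e2
  linarith

theorem summable_seriesTerm (hm : 1 ≤ m) (hb : 0 < b) (x : ℂ × ℂ) :
    Summable fun i => seriesTerm m b i x :=
  Summable.of_norm_bounded (summable_seriesCoeff_mul_pow hm hb (norm_nonneg x) 2)
    fun i => norm_seriesTerm_le hb le_rfl i

theorem exists_hasFDerivAt_pow_mul_pow {R : ℝ} (hR : 1 ≤ R) {x : ℂ × ℂ} (hx : ‖x‖ ≤ R) (a b : ℕ) :
    ∃ L : ℂ × ℂ →L[ℂ] ℂ, HasFDerivAt (fun y : ℂ × ℂ => y.1 ^ a * y.2 ^ b) L x ∧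
      ‖L‖ ≤ (2 * R) ^ (a + b) := by
  have h1 := (norm_fst_le x).trans hx
  have h2 := (norm_snd_le x).trans hx
  refine ⟨_, (hasFDerivAt_fst.pow a).mul (hasFDerivAt_snd.pow b), ?_⟩
  have hpow : ∀ (n : ℕ) (z : ℂ), ‖z‖ ≤ R → ‖(n : ℂ) * z ^ (n - 1)‖ ≤ n * R ^ n := by
    intro n z hz
    rw [norm_mul, norm_pow, Complex.norm_natCast]
    gcongr
    exact (pow_le_pow_left₀ (norm_nonneg z) hz _).trans (pow_le_pow_right₀ hR (Nat.sub_le n 1))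
  have hp : ∀ (n : ℕ) (z : ℂ), ‖z‖ ≤ R → ‖z ^ n‖ ≤ R ^ n := fun n z hz => by
    rw [norm_pow]; exact pow_le_pow_left₀ (norm_nonneg z) hz n
  have hR0 : 0 ≤ R := by linarith
  refine (norm_add_le _ _).trans ?_
  simp only [norm_smul, nsmul_eq_mul]
  have i1 : ‖x.1 ^ a‖ * (‖(b : ℂ) * x.2 ^ (b - 1)‖ * ‖ContinuousLinearMap.snd ℂ ℂ ℂ‖) ≤
      R ^ a * (b * R ^ b * 1) := by
    gcongr
    · exact hp _ _ h1
    · exact hpow _ _ h2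
    · exact ContinuousLinearMap.norm_snd_le ℂ ℂ ℂ
  have i2 : ‖x.2 ^ b‖ * (‖(a : ℂ) * x.1 ^ (a - 1)‖ * ‖ContinuousLinearMap.fst ℂ ℂ ℂ‖) ≤
      R ^ b * (a * R ^ a * 1) := by
    gcongr
    · exact hp _ _ h2
    · exact hpow _ _ h1
    · exact ContinuousLinearMap.norm_fst_le ℂ ℂ ℂ
  -- The degree produced by differentiation is absorbed by doubling the radius, so the summability
  -- bound for the terms also serves their derivatives.
  have i3 : ((a + b : ℕ) : ℝ) ≤ 2 ^ (a + b) := by exact_mod_cast Nat.lt_two_pow_self.le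
  calc _ ≤ R ^ a * (b * R ^ b * 1) + R ^ b * (a * R ^ a * 1) := add_le_add i1 i2
    _ = ((a + b : ℕ) : ℝ) * R ^ (a + b) := by push_cast; ring
    _ ≤ 2 ^ (a + b) * R ^ (a + b) := by gcongr
    _ = _ := by rw [mul_pow]

theorem exists_hasFDerivAt_seriesTerm (hb : 0 < b) {R : ℝ} (hR : 1 ≤ R) {x : ℂ × ℂ}
    (hx : ‖x‖ ≤ R) (i : ℕ × ℕ) :
    ∃ L : ℂ × ℂ →L[ℂ] ℂ, HasFDerivAt (seriesTerm m b i) L x ∧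
      ‖L‖ ≤ seriesCoeff m b i.1 i.2 * (2 * (2 * R) ^ (4 * i.1 + 2 * i.2 + 1)) := by
  obtain ⟨L₁, h₁, e₁⟩ := exists_hasFDerivAt_pow_mul_pow hR hx (2 * i.1 + 2 * i.2 + 1) (2 * i.1)
  obtain ⟨L₂, h₂, e₂⟩ := exists_hasFDerivAt_pow_mul_pow hR hx (2 * i.1) (2 * i.1 + 2 * i.2 + 1)
  refine ⟨_, (h₁.sub h₂).const_mul (seriesCoeff m b i.1 i.2 : ℂ), ?_⟩
  rw [norm_smul, Complex.norm_real, Real.norm_of_nonneg (seriesCoeff_pos hb _ _).le]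
  refine mul_le_mul_of_nonneg_left ((norm_sub_le _ _).trans ?_) (seriesCoeff_pos hb _ _).le
  rw [show 2 * i.1 + 2 * i.2 + 1 + 2 * i.1 = 4 * i.1 + 2 * i.2 + 1 by ring] at e₁
  rw [show 2 * i.1 + (2 * i.1 + 2 * i.2 + 1) = 4 * i.1 + 2 * i.2 + 1 by ring] at e₂
  linarith

theorem differentiable_series (hm : 1 ≤ m) (hb : 0 < b) : Differentiable ℂ (series m b) := by
  intro x
  have hR : 1 ≤ ‖x‖ + 1 := by linarith [norm_nonneg x]
  have hball : ∀ y ∈ Metric.ball (0 : ℂ × ℂ) (‖x‖ + 1), ‖y‖ ≤ ‖x‖ + 1 := fun y hy =>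
    (mem_ball_zero_iff.mp hy).le
  refine (hasFDerivAt_tsum_of_isPreconnected (f' := fun i => fderiv ℂ (seriesTerm m b i))
    (summable_seriesCoeff_mul_pow hm hb (by linarith : 0 ≤ 2 * (‖x‖ + 1)) 2) Metric.isOpen_ball
    (convex_ball (0 : ℂ × ℂ) (‖x‖ + 1)).isPreconnected (fun i y hy => ?_) (fun i y hy => ?_)
    (Metric.mem_ball_self (by linarith)) (summable_seriesTerm hm hb 0)
    (mem_ball_zero_iff.mpr (by linarith))).differentiableAt
  · obtain ⟨L, h, -⟩ := exists_hasFDerivAt_seriesTerm (m := m) hb hR (hball y hy) i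
    exact h.differentiableAt.hasFDerivAt
  · obtain ⟨L, h, e⟩ := exists_hasFDerivAt_seriesTerm (m := m) hb hR (hball y hy) i
    rwa [h.fderiv]

/-- The partial sums of the double series over `l + p < N`. -/
def partialSeries (m : ℕ) (b : ℝ) (N : ℕ) (x : ℂ × ℂ) : ℂ :=
  ∑ k ∈ Finset.range N, ∑ i ∈ Finset.HasAntidiagonal.antidiagonal k, seriesTerm m b i x

theorem tendstoLocallyUniformly_partialSeries (hm : 1 ≤ m) (hb : 0 < b) :
    TendstoLocallyUniformly (partialSeries m b) (series m b) atTop := by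
  let T : ℕ → Finset (ℕ × ℕ) := fun N => (Finset.range N).biUnion Finset.HasAntidiagonal.antidiagonal
  have hmem : ∀ N i, i ∈ T N ↔ i.1 + i.2 < N := by
    intro N i
    simp [T]
  -- The triangles `l + p < N` exhaust `ℕ × ℕ`, so unconditional uniform summation applies along
  -- them.
  have hT : Tendsto T atTop atTop := by
    refine tendsto_atTop_finset_of_monotone (fun M N hMN i hi => ?_) fun i =>
      ⟨i.1 + i.2 + 1, (hmem _ _).mpr (Nat.lt_succ_self _)⟩
    exact (hmem _ _).mpr (((hmem _ _).mp hi).trans_le hMN)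
  have hsum : ∀ N x, partialSeries m b N x = ∑ i ∈ T N, seriesTerm m b i x := by
    intro N x
    rw [partialSeries, Finset.sum_biUnion]
    intro k _ l _ hkl
    rw [Function.onFun, Finset.disjoint_left]
    intro i hi hi'
    rw [Finset.HasAntidiagonal.mem_antidiagonal] at hi hi'
    exact hkl (hi.symm.trans hi')
  rw [tendstoLocallyUniformly_iff_forall_isCompact]
  intro K hK
  obtain ⟨R, hR⟩ := hK.isBounded.exists_norm_le
  have hR' : 0 ≤ max R 0 := le_max_right _ _
  have := tendstoUniformlyOn_tsum (f := seriesTerm m b) (s := K)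
    (summable_seriesCoeff_mul_pow hm hb hR' 2)
    fun i x hx => norm_seriesTerm_le hb ((hR x hx).trans (le_max_left _ _)) i
  intro u hu
  filter_upwards [hT.eventually (this u hu)] with N hN x hx
  rw [hsum]
  exact hN x hx

end

section

/-! ### The rescaled pre-kernel is a partial sum of the double series -/

variable {m : ℕ} {c : ℝ} {N : ℕ}

theorem seriesCoeff_eq_prod {b : ℝ} (hb : 0 < b) (l p : ℕ) :
    seriesCoeff m b l p =
      (∏ i ∈ Finset.range p, Real.Gamma (b + m * (2 * (l + i) + 2 : ℕ)) /
        Real.Gamma (b + m * (2 * (l + i) + 1 : ℕ))) / Real.Gamma (b + m * (2 * (l + p) + 1 : ℕ)) := by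
  have hΓ : ∀ n : ℕ, Real.Gamma (b + m * n) ≠ 0 := fun n =>
    (Real.Gamma_pos_of_pos (by positivity)).ne'
  have e1 : ∀ n : ℕ, b + (2 * m : ℕ) * n = b + m * (2 * n : ℕ) := fun n => by push_cast; ring
  have e2 : ∀ n : ℕ, b + (m : ℝ) * (2 * n : ℕ) + m = b + m * (2 * n + 1 : ℕ) := fun n => by
    push_cast; ring
  simp only [seriesCoeff, gammaRatio, e1, e2]
  induction p with
  | zero =>
    have := hΓ (2 * l)
    simp only [zero_add, Finset.prod_range_one, add_zero, Finset.prod_range_zero]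
    field_simp
  | succ p ih =>
    rw [Finset.prod_range_succ, ← mul_assoc, ih, Finset.prod_range_succ,
      show 2 * (l + (p + 1)) = 2 * (l + p) + 2 by ring]
    ring

theorem moment_eq_mul_pow (hN : 1 ≤ N) (k : ℕ) : moment m c N k =
    m * Real.Gamma (m * (1 + c) + m * k) *
      ((N : ℝ) ^ (-(m * (1 + c))) * (((N : ℝ) ^ (-((m : ℝ) / 2))) ^ 2) ^ k) := by
  have h2 : (0 : ℝ) < N := by exact_mod_cast hN
  rw [moment, ← pow_mul, ← Real.rpow_natCast, ← Real.rpow_mul h2.le, ← Real.rpow_add h2]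
  congr 2
  push_cast
  ring

/-- With `ν = N^{-m/2}`, the moment ratios give `ν^{2p}` and the skew-norm `ν^{-(4(l+p)+2)}`.
Together with `ν^{4l+2p+1}` from the rescaled monomials only `ν⁻¹` is left, so the dependence on `N`
is the same for all `l`, `p`. -/
theorem evenCoeff_div_moment (hm : 1 ≤ m) (hc : -1 < c) (hN : 1 ≤ N) (l p : ℕ) :
    evenCoeff m c N (l + p) l / moment m c N (2 * (l + p) + 1) *
        ((N : ℝ) ^ (-((m : ℝ) / 2))) ^ (4 * l + 2 * p + 1) =
      seriesCoeff m (m * (1 + c)) l p *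
        ((N : ℝ) ^ (m * (1 + c)) / (m * (N : ℝ) ^ (-((m : ℝ) / 2)))) := by
  have hb := cast_mul_one_add_pos hm hc
  have h1 : (0 : ℝ) < m := by exact_mod_cast hm
  have h2 : (0 : ℝ) < N := by exact_mod_cast hN
  rw [seriesCoeff_eq_prod hb]
  simp only [evenCoeff, moment_eq_mul_pow hN, Nat.add_sub_cancel_left, Real.rpow_neg h2.le
    (m * (1 + c))]
  set ν := (N : ℝ) ^ (-((m : ℝ) / 2))
  set b := (m : ℝ) * (1 + c) with hbdef
  have hν0 : ν ≠ 0 := (Real.rpow_pos_of_pos h2 _).ne'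
  have hNb : (N : ℝ) ^ b ≠ 0 := (Real.rpow_pos_of_pos h2 _).ne'
  have hΓ : ∀ n : ℕ, Real.Gamma (b + m * n) ≠ 0 := fun n =>
    (Real.Gamma_pos_of_pos (by positivity)).ne'
  have e : ∀ i : ℕ, (m * Real.Gamma (b + m * (2 * (l + i) + 2 : ℕ)) *
      (((N : ℝ) ^ b)⁻¹ * (ν ^ 2) ^ (2 * (l + i) + 2))) /
      (m * Real.Gamma (b + m * (2 * (l + i) + 1 : ℕ)) *
      (((N : ℝ) ^ b)⁻¹ * (ν ^ 2) ^ (2 * (l + i) + 1))) =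
      Real.Gamma (b + m * (2 * (l + i) + 2 : ℕ)) / Real.Gamma (b + m * (2 * (l + i) + 1 : ℕ)) *
        ν ^ 2 := by
    intro i
    have := hΓ (2 * (l + i) + 1)
    rw [pow_succ _ (2 * (l + i) + 1)]
    field_simp
  simp only [e, Finset.prod_mul_distrib, Finset.prod_const, Finset.card_range]
  have := hΓ (2 * (l + p) + 1)
  field_simp
  ring

/-- `ρ = (2m)^{m/2}`. -/
def scaleConst (m : ℕ) : ℝ := (2 * (m : ℝ)) ^ ((m : ℝ) / 2)

theorem scaleConst_pos (hm : 1 ≤ m) : 0 < scaleConst m := by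
  have h1 : (0 : ℝ) < m := by exact_mod_cast hm
  exact Real.rpow_pos_of_pos (by positivity) _

theorem microScale_eq (hm : 1 ≤ m) :
    microScale (1 / (m : ℝ)) N = scaleConst m * (N : ℝ) ^ (-((m : ℝ) / 2)) := by
  have h1 : (0 : ℝ) < m := by exact_mod_cast hm
  rw [microScale, scaleConst, Real.mul_rpow (by positivity) (by positivity),
    show 1 / (m : ℝ) / 2 = (2 * (m : ℝ))⁻¹ by field_simp,
    show -(1 / (2 * (1 / (m : ℝ)))) = -((m : ℝ) / 2) by field_simp,
    Real.inv_rpow (by positivity), ← Real.rpow_neg (by positivity), neg_neg]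

/-- Since `r_N = ρ N^{-m/2}` with `ρ² = (2m)^m`, the power `r_N^{2c+2}` is `(2m)^{m(1+c)}
N^{-m(1+c)}` and removes the remaining power of `N`. The factor `2` on the right is cancelled by the
one in `s_k = 2 h_{2k+1}`. -/
theorem microScale_rpow_mul (hm : 1 ≤ m) (hN : 1 ≤ N) :
    microScale (1 / (m : ℝ)) N ^ (2 * c) * microScale (1 / (m : ℝ)) N ^ 3 *
      ((N : ℝ) ^ (m * (1 + c)) / (m * (N : ℝ) ^ (-((m : ℝ) / 2)))) =
      2 * (scaleConst m * (2 * (m : ℝ)) ^ (m * (1 + c) - 1)) := by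
  have h1 : (0 : ℝ) < m := by exact_mod_cast hm
  have h2 : (0 : ℝ) < N := by exact_mod_cast hN
  have hr : 0 < microScale (1 / (m : ℝ)) N := by
    rw [microScale_eq hm]
    exact mul_pos (scaleConst_pos hm) (Real.rpow_pos_of_pos h2 _)
  have e1 : microScale (1 / (m : ℝ)) N ^ (2 * c) * microScale (1 / (m : ℝ)) N ^ 3 =
      microScale (1 / (m : ℝ)) N ^ (2 * c + 2) * microScale (1 / (m : ℝ)) N := by
    rw [← Real.rpow_natCast, ← Real.rpow_add hr, ← Real.rpow_add_one hr.ne']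
    congr 1
    push_cast
    ring
  rw [e1, microScale_eq hm, Real.mul_rpow (scaleConst_pos hm).le (by positivity), scaleConst,
    ← Real.rpow_mul (by positivity), ← Real.rpow_mul (by positivity),
    show (m : ℝ) / 2 * (2 * c + 2) = m * (1 + c) by ring,
    show -((m : ℝ) / 2) * (2 * c + 2) = -(m * (1 + c)) by ring, Real.rpow_neg h2.le (m * (1 + c)),
    Real.rpow_sub_one (by positivity)]
  have := (Real.rpow_pos_of_pos h2 (m * (1 + c))).ne'
  have := (Real.rpow_pos_of_pos h2 (-((m : ℝ) / 2))).ne'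
  field_simp

/-- The summand `k` of the pre-kernel is the antidiagonal `l + p = k` of the series, `2l` being the
degree of a monomial of `q_{2k}`; `N` survives only as the cut-off. -/
theorem microScale_rpow_mul_rescaledPreKernel_skewPoly (hm : 1 ≤ m) (hc : -1 < c) (hN : 1 ≤ N)
    (z w : ℂ) :
    ((microScale (1 / (m : ℝ)) N ^ (2 * c) : ℝ) : ℂ) *
      rescaledPreKernel (1 / (m : ℝ)) N (skewPoly m c N) (fun k => 2 * moment m c N (2 * k + 1)) z w =
    ((scaleConst m * (2 * (m : ℝ)) ^ (m * (1 + c) - 1) : ℝ) : ℂ) *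
      partialSeries m (m * (1 + c)) N (scaleConst m * z, scaleConst m * w) := by
  rw [rescaledPreKernel, preKernel, partialSeries, Finset.mul_sum, Finset.mul_sum, Finset.mul_sum]
  refine Finset.sum_congr rfl fun k _ => ?_
  have hodd : ∀ ζ, polyFun (skewPoly m c N (2 * k + 1)) ζ = ζ ^ (2 * k + 1) := fun ζ => by
    rw [polyFun, skewPoly_odd]; simp
  have heven : ∀ ζ, polyFun (skewPoly m c N (2 * k)) ζ =
      ∑ i ∈ Finset.HasAntidiagonal.antidiagonal k,
        (evenCoeff m c N (i.1 + i.2) i.1 : ℂ) * ζ ^ (2 * i.1) := fun ζ => by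
    rw [polyFun, skewPoly_even, Finset.Nat.sum_antidiagonal_eq_sum_range_succ
      (fun l p => (evenCoeff m c N (l + p) l : ℂ) * ζ ^ (2 * l)), map_sum]
    refine Finset.sum_congr rfl fun l hl => ?_
    rw [Nat.add_sub_cancel' (Nat.lt_succ_iff.mp (Finset.mem_range.mp hl))]
    simp
  rw [hodd, hodd, heven, heven, Finset.mul_sum, Finset.sum_mul, ← Finset.sum_sub_distrib,
    Finset.sum_div, Finset.mul_sum, Finset.mul_sum, Finset.mul_sum]
  refine Finset.sum_congr rfl fun i hi => ?_
  obtain ⟨l, p⟩ := i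
  obtain rfl : l + p = k := Finset.HasAntidiagonal.mem_antidiagonal.mp hi
  have key := microScale_rpow_mul (c := c) hm hN
  have key2 := evenCoeff_div_moment hm hc hN l p
  have hmom := (moment_pos hm hc hN (2 * (l + p) + 1)).ne'
  have hms : ((microScale (1 / (m : ℝ)) N : ℝ) : ℂ) =
    (scaleConst m : ℂ) * (((N : ℝ) ^ (-((m : ℝ) / 2)) : ℝ) : ℂ) := by
    rw [microScale_eq hm]; push_cast; rfl
  simp only [seriesTerm]
  generalize evenCoeff m c N (l + p) l = e at *
  generalize moment m c N (2 * (l + p) + 1) = h at *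
  generalize seriesCoeff m (m * (1 + c)) l p = s at *
  generalize scaleConst m * (2 * (m : ℝ)) ^ (m * (1 + c) - 1) = K at *
  generalize (N : ℝ) ^ (m * (1 + c)) / (m * (N : ℝ) ^ (-((m : ℝ) / 2))) = D at *
  generalize microScale (1 / (m : ℝ)) N ^ (2 * c) = r2 at *
  have scalar : r2 * microScale (1 / (m : ℝ)) N ^ 3 * (e / h / 2 *
      ((N : ℝ) ^ (-((m : ℝ) / 2))) ^ (4 * l + 2 * p + 1)) = K * s := by
    linear_combination (r2 * microScale (1 / (m : ℝ)) N ^ 3 / 2) * key2 + s / 2 * key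
  have scalarC := congrArg (fun x : ℝ => (x : ℂ)) scalar
  push_cast at scalarC ⊢
  generalize ((microScale (1 / (m : ℝ)) N : ℝ) : ℂ) = r at *
  generalize (((N : ℝ) ^ (-((m : ℝ) / 2)) : ℝ) : ℂ) = ν at *
  have hmomC : (h : ℂ) ≠ 0 := by exact_mod_cast hmom
  rw [← mul_assoc (K : ℂ), ← scalarC, hms]
  field_simp
  ring

end

section

/-! ### Convergence of the kernels -/

variable {m : ℕ} {c : ℝ} {N : ℕ}

theorem tendstoLocallyUniformly_iff_tendsto {ι α β : Type*} [TopologicalSpace α] [UniformSpace β]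
    {F : ι → α → β} {f : α → β} {p : Filter ι} (hf : Continuous f) :
    TendstoLocallyUniformly F f p ↔
      ∀ x, Tendsto (fun y : ι × α => F y.1 y.2) (p ×ˢ 𝓝 x) (𝓝 (f x)) := by
  rw [tendstoLocallyUniformly_iff_forall_tendsto]
  refine forall_congr' fun x => ?_
  have hfx : Tendsto (fun y : ι × α => f y.2) (p ×ˢ 𝓝 x) (𝓝 (f x)) :=
    (hf.tendsto x).comp tendsto_snd
  refine ⟨fun h => ?_, fun h => ?_⟩
  · exact hfx.congr_uniformity h
  · exact (hfx.prodMk_nhds h).mono_right (nhds_le_uniformity _)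

/-- The entire function `P(z, w)`. -/
def entireKernel (m : ℕ) (c : ℝ) (x : ℂ × ℂ) : ℂ :=
  ((scaleConst m * (2 * (m : ℝ)) ^ (m * (1 + c) - 1) : ℝ) : ℂ) *
    series m (m * (1 + c)) (scaleConst m * x.1, scaleConst m * x.2)

theorem differentiable_entireKernel (hm : 1 ≤ m) (hc : -1 < c) :
    Differentiable ℂ (entireKernel m c) := by
  have := differentiable_series hm (cast_mul_one_add_pos hm hc)
  exact (this.comp (by fun_prop : Differentiable ℂ fun x : ℂ × ℂ =>
    ((scaleConst m : ℂ) * x.1, (scaleConst m : ℂ) * x.2))).const_mul _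

theorem tendstoLocallyUniformly_rescaledPreKernel (hm : 1 ≤ m) (hc : -1 < c)
    {q : ℕ → ℕ → Polynomial ℝ} {s : ℕ → ℕ → ℝ}
    (h : ∀ N : ℕ, 1 ≤ N → IsSkewOrthogonal N (potential (1 / (m : ℝ)) c N) (q N) (s N)) :
    TendstoLocallyUniformly
      (fun (N : ℕ) (p : ℂ × ℂ) => ((microScale (1 / (m : ℝ)) N ^ (2 * c) : ℝ) : ℂ) *
        rescaledPreKernel (1 / (m : ℝ)) N (q N) (s N) p.1 p.2)
      (entireKernel m c) atTop := by
  have hb := cast_mul_one_add_pos hm hc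
  rw [tendstoLocallyUniformly_iff_tendsto (differentiable_entireKernel hm hc).continuous]
  intro x
  have hg : Continuous fun x : ℂ × ℂ => ((scaleConst m : ℂ) * x.1, (scaleConst m : ℂ) * x.2) := by
    fun_prop
  have h1 := (tendstoLocallyUniformly_iff_tendsto (differentiable_series hm hb).continuous).mp
    (tendstoLocallyUniformly_partialSeries hm hb) ((scaleConst m : ℂ) * x.1, (scaleConst m : ℂ) * x.2)
  have h2 := (h1.comp (tendsto_id.prodMap (hg.tendsto x))).const_mul
    ((scaleConst m * (2 * (m : ℝ)) ^ (m * (1 + c) - 1) : ℝ) : ℂ)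
  refine h2.congr' ?_
  filter_upwards [prod_mem_prod (eventually_ge_atTop 1) univ_mem] with y hy
  have hy1 : 1 ≤ y.1 := hy.1
  rw [rescaledPreKernel, (h y.1 hy1).preKernel_eq hm hc hy1 (isSkewOrthogonal_skewPoly hm hc hy1),
    ← rescaledPreKernel, microScale_rpow_mul_rescaledPreKernel_skewPoly hm hc hy1]
  rfl

theorem microScale_pos (hm : 1 ≤ m) (hN : 1 ≤ N) : 0 < microScale (1 / (m : ℝ)) N := by
  have h1 : (0 : ℝ) < m := by exact_mod_cast hm
  have h2 : (0 : ℝ) < N := by exact_mod_cast hN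
  exact Real.rpow_pos_of_pos (by positivity) _

theorem half_mul_potential (hm : 1 ≤ m) (hN : 1 ≤ N) (Z : ℂ) :
    -((N : ℝ) / 2) * potential (1 / (m : ℝ)) c N
      ((microScale (1 / (m : ℝ)) N : ℂ) * Complex.exp Z) =
    -(‖Complex.exp Z‖ ^ (2 * (1 / (m : ℝ))) / (1 / (m : ℝ))) +
      (Real.log (microScale (1 / (m : ℝ)) N) * c + c * Z.re) := by
  have h1 : (0 : ℝ) < m := by exact_mod_cast hm
  have h2 : (0 : ℝ) < N := by exact_mod_cast hN
  have hr := microScale_pos hm hN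
  have e1 : microScale (1 / (m : ℝ)) N ^ (2 * (1 / (m : ℝ))) = (1 / (m : ℝ) / 2 * N)⁻¹ := by
    rw [microScale, ← Real.rpow_mul (by positivity), ← Real.rpow_neg_one]
    congr 1
    field_simp
  rw [potential, norm_mul, Complex.norm_real, Real.norm_of_nonneg hr.le,
    Real.mul_rpow hr.le (norm_nonneg _), e1,
    Real.log_mul hr.ne' (norm_ne_zero_iff.mpr (Complex.exp_ne_zero _)), Complex.norm_exp,
    Real.log_exp]
  field_simp
  ring

/-- The logarithm in the potential contributes `r_N^{2c} |z|^c |w|^c`, and the cocycle completes the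
moduli to `(zw)^c`. Conjugation keeps real parts, so one real prefactor serves all four entries. -/
theorem finiteKernel_eq_limitKernel (hm : 1 ≤ m) (hN : 1 ≤ N) (q : ℕ → Polynomial ℝ) (s : ℕ → ℝ)
    (Z W : ℂ) :
    finiteKernel (1 / (m : ℝ)) c N q s Z W = limitKernel (1 / (m : ℝ)) (fun U V =>
      Complex.exp ((c : ℂ) * (U + V)) * (((microScale (1 / (m : ℝ)) N ^ (2 * c) : ℝ) : ℂ) *
        rescaledPreKernel (1 / (m : ℝ)) N q s (Complex.exp U) (Complex.exp V))) Z W := by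
  have hr := microScale_pos hm hN
  have hfac : Real.exp (-((N : ℝ) / 2) *
      (potential (1 / (m : ℝ)) c N ((microScale (1 / (m : ℝ)) N : ℂ) * Complex.exp Z) +
        potential (1 / (m : ℝ)) c N ((microScale (1 / (m : ℝ)) N : ℂ) * Complex.exp W))) =
      Real.exp (-((‖Complex.exp Z‖ ^ (2 * (1 / (m : ℝ))) + ‖Complex.exp W‖ ^ (2 * (1 / (m : ℝ)))) /
        (1 / (m : ℝ)))) * (Real.exp (c * Z.re + c * W.re) *
          microScale (1 / (m : ℝ)) N ^ (2 * c)) := by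
    rw [mul_add, half_mul_potential hm hN, half_mul_potential hm hN, Real.rpow_def_of_pos hr,
      ← Real.exp_add, ← Real.exp_add]
    congr 1
    ring
  have hU : ∀ U V : ℂ, U.re = Z.re → V.re = W.re →
      ((Real.exp (c * Z.re + c * W.re) : ℝ) : ℂ) * (unimodular c U * unimodular c V) =
        Complex.exp ((c : ℂ) * (U + V)) := by
    intro U V h1 h2
    rw [unimodular, unimodular, Complex.ofReal_exp, ← Complex.exp_add, ← Complex.exp_add]
    congr 1
    conv_rhs => rw [← Complex.re_add_im U, ← Complex.re_add_im V]
    rw [h1, h2]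
    push_cast
    ring
  have hcr : ∀ x : ℂ, (conj x).re = x.re := Complex.conj_re
  have key : ∀ U V : ℂ, U.re = Z.re → V.re = W.re → ∀ A r κ : ℂ,
      A * (((Real.exp (c * Z.re + c * W.re) : ℝ) : ℂ) * r) * (unimodular c U * unimodular c V * κ) =
        A * (Complex.exp ((c : ℂ) * (U + V)) * (r * κ)) := by
    intro U V h1 h2 A r κ
    rw [← hU U V h1 h2]
    ring
  rw [finiteKernel, limitKernel, hfac, Complex.ofReal_mul, Complex.ofReal_mul]
  ext i j
  fin_cases i <;> fin_cases j
  · exact key _ _ rfl rfl _ _ _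
  · exact key _ _ rfl (hcr _) _ _ _
  · exact key _ _ (hcr _) rfl _ _ _
  · exact key _ _ (hcr _) (hcr _) _ _ _

theorem continuous_limitKernel (hm : 1 ≤ m) {κ : ℂ → ℂ → ℂ} (hκ : Continuous fun p : ℂ × ℂ => κ p.1 p.2) :
    Continuous fun p : ℂ × ℂ => limitKernel (1 / (m : ℝ)) κ p.1 p.2 := by
  have h1 : (0 : ℝ) < m := by exact_mod_cast hm
  have hpow : Continuous fun Z : ℂ => ‖Complex.exp Z‖ ^ (2 * (1 / (m : ℝ))) :=
    (by fun_prop : Continuous fun Z : ℂ => ‖Complex.exp Z‖).rpow_const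
      fun Z => Or.inl (norm_ne_zero_iff.mpr (Complex.exp_ne_zero Z))
  refine continuous_matrix fun i j => ?_
  refine Continuous.mul ?_ ?_
  · exact Complex.continuous_ofReal.comp (Real.continuous_exp.comp
      (((hpow.comp continuous_fst).add (hpow.comp continuous_snd)).div_const _).neg)
  · fin_cases i <;> fin_cases j
    · exact hκ
    · exact hκ.comp (by fun_prop : Continuous fun p : ℂ × ℂ => (p.1, conj p.2))
    · exact hκ.comp (by fun_prop : Continuous fun p : ℂ × ℂ => (conj p.1, p.2))
    · exact hκ.comp (by fun_prop : Continuous fun p : ℂ × ℂ => (conj p.1, conj p.2))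

theorem tendstoLocallyUniformly_limitKernel (hm : 1 ≤ m) {κ : ℂ → ℂ → ℂ} {κN : ℕ → ℂ → ℂ → ℂ}
    (hκ : Continuous fun p : ℂ × ℂ => κ p.1 p.2)
    (h : ∀ x : ℂ × ℂ, Tendsto (fun y : ℕ × (ℂ × ℂ) => κN y.1 y.2.1 y.2.2) (atTop ×ˢ 𝓝 x)
      (𝓝 (κ x.1 x.2))) :
    TendstoLocallyUniformly (fun N p => limitKernel (1 / (m : ℝ)) (κN N) p.1 p.2)
      (fun p : ℂ × ℂ => limitKernel (1 / (m : ℝ)) κ p.1 p.2) atTop := by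
  -- With the constant pre-kernel `1`, every entry is the scalar prefactor; this isolates it from
  -- the converging pre-kernel.
  have hc1 : Continuous fun p : ℂ × ℂ => limitKernel (1 / (m : ℝ)) (fun _ _ => 1) p.1 p.2 :=
    continuous_limitKernel hm continuous_const
  rw [tendstoLocallyUniformly_iff_tendsto (continuous_limitKernel hm hκ)]
  intro x
  refine tendsto_pi_nhds.mpr fun i => tendsto_pi_nhds.mpr fun j => ?_
  have hfac : Tendsto (fun y : ℕ × (ℂ × ℂ) =>
      limitKernel (1 / (m : ℝ)) (fun _ _ => 1) y.2.1 y.2.2 0 0) (atTop ×ˢ 𝓝 x)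
      (𝓝 (limitKernel (1 / (m : ℝ)) (fun _ _ => 1) x.1 x.2 0 0)) :=
    ((hc1.matrix_elem 0 0).tendsto x).comp tendsto_snd
  have hcomp : ∀ g : ℂ × ℂ → ℂ × ℂ, Continuous g →
      Tendsto (fun y : ℕ × (ℂ × ℂ) => κN y.1 (g y.2).1 (g y.2).2) (atTop ×ˢ 𝓝 x)
        (𝓝 (κ (g x).1 (g x).2)) := fun g hg =>
    (h (g x)).comp (tendsto_id.prodMap (hg.tendsto x))
  have e : ∀ (κ : ℂ → ℂ → ℂ) (Z W : ℂ) (i j : Fin 2), limitKernel (1 / (m : ℝ)) κ Z W i j =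
      limitKernel (1 / (m : ℝ)) (fun _ _ => 1) Z W 0 0 * kernelMatrix κ Z W i j := by
    intro κ Z W i j
    simp [limitKernel, kernelMatrix]
  simp only [e κ, e (κN _)]
  refine hfac.mul ?_
  fin_cases i <;> fin_cases j
  · exact hcomp id continuous_id
  · exact hcomp (fun p => (p.1, conj p.2)) (by fun_prop)
  · exact hcomp (fun p => (conj p.1, p.2)) (by fun_prop)
  · exact hcomp (fun p => (conj p.1, conj p.2)) (by fun_prop)

theorem tendstoLocallyUniformly_finiteKernel (hm : 1 ≤ m) (hc : -1 < c)
    {q : ℕ → ℕ → Polynomial ℝ} {s : ℕ → ℕ → ℝ}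
    (h : ∀ N : ℕ, 1 ≤ N → IsSkewOrthogonal N (potential (1 / (m : ℝ)) c N) (q N) (s N))
    {κ : ℂ → ℂ → ℂ} (hκ : ∀ Z W, κ Z W =
      Complex.exp ((c : ℂ) * (Z + W)) * entireKernel m c (Complex.exp Z, Complex.exp W)) :
    TendstoLocallyUniformly
      (fun (N : ℕ) (p : ℂ × ℂ) => finiteKernel (1 / (m : ℝ)) c N (q N) (s N) p.1 p.2)
      (fun p : ℂ × ℂ => limitKernel (1 / (m : ℝ)) κ p.1 p.2) atTop := by
  have hcont := (differentiable_entireKernel hm hc).continuous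
  have hexp : Continuous fun p : ℂ × ℂ => (Complex.exp p.1, Complex.exp p.2) := by fun_prop
  have hexp2 : Continuous fun p : ℂ × ℂ => Complex.exp ((c : ℂ) * (p.1 + p.2)) := by fun_prop
  have hκc : Continuous fun p : ℂ × ℂ => κ p.1 p.2 := by
    simp only [hκ]
    exact hexp2.mul (hcont.comp hexp)
  have hlim := tendstoLocallyUniformly_limitKernel hm (κN := fun N U V =>
      Complex.exp ((c : ℂ) * (U + V)) * (((microScale (1 / (m : ℝ)) N ^ (2 * c) : ℝ) : ℂ) *
        rescaledPreKernel (1 / (m : ℝ)) N (q N) (s N) (Complex.exp U) (Complex.exp V))) hκc ?_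
  · intro u hu x
    obtain ⟨t, ht, hN⟩ := hlim u hu x
    refine ⟨t, ht, ?_⟩
    filter_upwards [hN, eventually_ge_atTop 1] with N hN h1 y hy
    rw [finiteKernel_eq_limitKernel hm h1]
    exact hN y hy
  · intro x
    rw [hκ]
    have h0 := tendstoLocallyUniformly_rescaledPreKernel hm hc h
    generalize hR : (fun (N : ℕ) (p : ℂ × ℂ) => ((microScale (1 / (m : ℝ)) N ^ (2 * c) : ℝ) : ℂ) *
        rescaledPreKernel (1 / (m : ℝ)) N (q N) (s N) p.1 p.2) = R at h0
    have hR' : ∀ N U V, ((microScale (1 / (m : ℝ)) N ^ (2 * c) : ℝ) : ℂ) *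
        rescaledPreKernel (1 / (m : ℝ)) N (q N) (s N) U V = R N (U, V) := fun N U V => by rw [← hR]
    simp only [hR']
    have h1 := (tendstoLocallyUniformly_iff_tendsto hcont).mp h0 (Complex.exp x.1, Complex.exp x.2)
    have h2 : Tendsto (fun y : ℕ × (ℂ × ℂ) => R y.1 (Complex.exp y.2.1, Complex.exp y.2.2))
        (atTop ×ˢ 𝓝 x) (𝓝 (entireKernel m c (Complex.exp x.1, Complex.exp x.2))) :=
      h1.comp (tendsto_id.prodMap (hexp.tendsto x))
    exact ((hexp2.tendsto x).comp tendsto_snd).mul h2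

end

section

/-! ### The functions `g_{j,m}` and their differential equation -/

/-- The `i`-th derivative of `∑ a_k z^{dk+r}`. -/
def lacunarySeries (a : ℕ → ℝ) (d r i : ℕ) (z : ℂ) : ℂ :=
  ∑' k : ℕ, ((a k * (d * k + r).descFactorial i : ℝ) : ℂ) * z ^ (d * k + r - i)

theorem norm_lacunary_term_le (a : ℕ → ℝ) (d r i : ℕ) {R : ℝ} (hR : 1 ≤ R) {z : ℂ} (hz : ‖z‖ ≤ R) (k : ℕ) :
    ‖((a k * (d * k + r).descFactorial i : ℝ) : ℂ) * z ^ (d * k + r - i)‖ ≤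
      (i.factorial * (2 * R) ^ r) * (|a k| * ((2 * R) ^ d) ^ k) := by
  rw [norm_mul, Complex.norm_real, norm_mul, norm_pow, Real.norm_eq_abs, Real.norm_natCast]
  have h1 : ((d * k + r).descFactorial i : ℝ) ≤ i.factorial * 2 ^ (d * k + r) := by
    rw [Nat.descFactorial_eq_factorial_mul_choose]
    exact_mod_cast Nat.mul_le_mul_left _ (Nat.choose_le_two_pow _ _)
  have h2 : ‖z‖ ^ (d * k + r - i) ≤ R ^ (d * k + r) :=
    (pow_le_pow_left₀ (norm_nonneg z) hz _).trans (pow_le_pow_right₀ hR (Nat.sub_le _ _))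
  calc _ ≤ |a k| * (i.factorial * 2 ^ (d * k + r)) * R ^ (d * k + r) := by gcongr
    _ = _ := by rw [← pow_mul, mul_pow, mul_pow, pow_add, pow_add]; ring

theorem summable_lacunary {a : ℕ → ℝ}
    (ha : ∀ R : ℝ, 0 ≤ R → Summable fun k => |a k| * R ^ k) (d r i : ℕ) (z : ℂ) :
    Summable fun k => ((a k * (d * k + r).descFactorial i : ℝ) : ℂ) * z ^ (d * k + r - i) :=
  Summable.of_norm_bounded ((ha ((2 * (‖z‖ + 1)) ^ d) (by positivity)).mul_left
    (i.factorial * (2 * (‖z‖ + 1)) ^ r))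
    (norm_lacunary_term_le a d r i (by linarith [norm_nonneg z]) (by linarith))

/-- The truncated exponent `d * k + r - i` is harmless: when `d * k + r < i` the falling factorial
already vanishes. -/
theorem hasDerivAt_lacunarySeries {a : ℕ → ℝ}
    (ha : ∀ R : ℝ, 0 ≤ R → Summable fun k => |a k| * R ^ k) (d r i : ℕ) (z : ℂ) :
    HasDerivAt (lacunarySeries a d r i) (lacunarySeries a d r (i + 1) z) z := by
  have hR : 1 ≤ ‖z‖ + 1 := by linarith [norm_nonneg z]
  refine hasDerivAt_tsum_of_isPreconnected
    (g := fun k y => ((a k * (d * k + r).descFactorial i : ℝ) : ℂ) * y ^ (d * k + r - i))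
    (g' := fun k y => ((a k * (d * k + r).descFactorial (i + 1) : ℝ) : ℂ) *
      y ^ (d * k + r - (i + 1)))
    ((ha ((2 * (‖z‖ + 1)) ^ d) (by positivity)).mul_left
      ((i + 1).factorial * (2 * (‖z‖ + 1)) ^ r)) (Metric.isOpen_ball (x := (0 : ℂ)) (ε := ‖z‖ + 1))
    (convex_ball (0 : ℂ) (‖z‖ + 1)).isPreconnected (fun k y _ => ?_) (fun k y hy => ?_)
    (Metric.mem_ball_self (by linarith)) (summable_lacunary ha d r i 0)
    (mem_ball_zero_iff.mpr (by linarith))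
  · convert! (hasDerivAt_pow (d * k + r - i) y).const_mul
      ((a k * (d * k + r).descFactorial i : ℝ) : ℂ) using 1
    rw [Nat.descFactorial_succ, Nat.sub_sub]
    push_cast
    ring
  · exact norm_lacunary_term_le a d r (i + 1) hR (mem_ball_zero_iff.mp hy).le k

theorem iteratedDeriv_lacunarySeries {a : ℕ → ℝ}
    (ha : ∀ R : ℝ, 0 ≤ R → Summable fun k => |a k| * R ^ k) (d r i : ℕ) :
    iteratedDeriv i (lacunarySeries a d r 0) = lacunarySeries a d r i := by
  induction i with
  | zero => simp
  | succ i ih =>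
    rw [iteratedDeriv_succ, ih]
    ext z
    exact (hasDerivAt_lacunarySeries ha d r i z).deriv

/-- The coefficients of `g_{r+1,m}`. -/
def gCoeff (m r k : ℕ) : ℝ :=
  ∏ i ∈ Finset.range k, gammaRatio m (((m + r + 1 : ℕ) : ℝ) + (2 * m : ℕ) * (0 + i : ℕ))

variable {m : ℕ}

theorem summable_gCoeff (hm : 1 ≤ m) (r : ℕ) {R : ℝ} (hR : 0 ≤ R) :
    Summable fun k => |gCoeff m r k| * R ^ k := by
  refine (Real.summable_pow_div_factorial ((min ((m + r + 1 : ℕ) : ℝ) 1)⁻¹ * R)).of_nonneg_of_le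
    (fun k => by positivity) fun k => ?_
  rw [gCoeff, abs_of_pos (Finset.prod_pos fun i _ => gammaRatio_pos _ (by positivity)), mul_pow,
    mul_div_right_comm]
  gcongr
  exact prod_gammaRatio_le hm (by positivity) 0 k

theorem g_eq_lacunarySeries (hm : 1 ≤ m) (r : ℕ) :
    g m (r + 1) = lacunarySeries (gCoeff m r) (2 * m) r 0 := by
  have h1 : (m : ℝ) ≠ 0 := by positivity
  ext z
  rw [g, kilbasSaigo, lacunarySeries, ← tsum_mul_left]
  refine tsum_congr fun k => ?_
  rw [Nat.descFactorial_zero, Nat.sub_zero, Nat.add_sub_cancel, pow_add, ← pow_mul]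
  have : (∏ j ∈ Finset.range k,
      ((Real.Gamma (m * (j * 2 + (1 + (((r + 1 : ℕ) : ℝ) - 1) / m)) + 1) /
        Real.Gamma (m * (j * 2 + (1 + (((r + 1 : ℕ) : ℝ) - 1) / m) + 1) + 1) : ℝ) : ℂ)) =
      (gCoeff m r k : ℂ) := by
    rw [gCoeff, Complex.ofReal_prod]
    refine Finset.prod_congr rfl fun i _ => ?_
    rw [gammaRatio]
    congr 3
    · push_cast; field_simp; ring
    · push_cast; field_simp; ring
  rw [this]
  push_cast
  ring

theorem gCoeff_succ_mul_descFactorial (m r k : ℕ) :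
    gCoeff m r (k + 1) * (2 * m * (k + 1) + r).descFactorial m = gCoeff m r k := by
  rw [gCoeff, Finset.prod_range_succ, ← gCoeff, gammaRatio_eq_inv_prod m (by positivity),
    show 2 * m * (k + 1) + r = (2 * m * k + m + r) + m by ring,
    Nat.add_descFactorial_eq_ascFactorial, Nat.ascFactorial_eq_prod_range, mul_assoc]
  push_cast
  have : ∏ i ∈ Finset.range m, ((m : ℝ) + r + 1 + 2 * m * (0 + k) + i) =
      ∏ i ∈ Finset.range m, (2 * (m : ℝ) * k + m + r + 1 + i) :=
    Finset.prod_congr rfl fun i _ => by ring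
  rw [this, inv_mul_cancel₀, mul_one]
  exact (Finset.prod_pos fun i _ => by positivity).ne'

/-- The differential equation `y^{(m)} = z^m y`. Differentiation kills the term `k = 0` because `r <
m`, and the coefficient recursion shifts the others by one step of `2m` in the exponent. -/
theorem lacunarySeries_gCoeff_self (hm : 1 ≤ m) {r : ℕ} (hr : r < m) (z : ℂ) :
    lacunarySeries (gCoeff m r) (2 * m) r m z =
      z ^ m * lacunarySeries (gCoeff m r) (2 * m) r 0 z := by
  rw [lacunarySeries, (summable_lacunary (fun R hR => summable_gCoeff hm r hR) _ _ _ _).tsum_eq_zero_add,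
    lacunarySeries, ← tsum_mul_left]
  rw [mul_zero, zero_add, Nat.descFactorial_eq_zero_iff_lt.mpr hr]
  simp only [Nat.cast_zero, mul_zero, Complex.ofReal_zero, zero_mul, zero_add]
  refine tsum_congr fun k => ?_
  rw [gCoeff_succ_mul_descFactorial, Nat.descFactorial_zero, Nat.sub_zero,
    show 2 * m * (k + 1) + r - m = m + (2 * m * k + r) by
      rw [mul_add]; omega, pow_add]
  push_cast
  ring

theorem lacunarySeries_gCoeff_zero {r i : ℕ} (hi : i < m) :
    lacunarySeries (gCoeff m r) (2 * m) r i 0 = if i = r then (r.factorial : ℂ) else 0 := by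
  rw [lacunarySeries, tsum_eq_single 0]
  · rw [mul_zero, zero_add]
    rcases lt_trichotomy i r with h | h | h
    · rw [if_neg h.ne, zero_pow (by omega), mul_zero]
    · subst h
      simp [gCoeff, Nat.descFactorial_self]
    · rw [Nat.descFactorial_eq_zero_iff_lt.mpr h, if_neg h.ne']
      simp
  · intro k hk
    have : 2 * m * 1 ≤ 2 * m * k := Nat.mul_le_mul_left _ (Nat.one_le_iff_ne_zero.mpr hk)
    rw [zero_pow (by omega), mul_zero]

/-! ### The fundamental matrix -/

/-- The matrix `(g_{k+1,m}^{(i)}(t))_{i,k}`. -/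
def fundMatrix (m : ℕ) (t : ℂ) : Matrix (Fin m) (Fin m) ℂ :=
  Matrix.of fun i k => lacunarySeries (gCoeff m k) (2 * m) k i t

/-- The companion matrix of `y^{(m)} = t^m y`. -/
def companion (m : ℕ) (t : ℂ) : Matrix (Fin m) (Fin m) ℂ :=
  Matrix.of fun i k => (if (k : ℕ) = i + 1 then 1 else 0) +
    if (i : ℕ) + 1 = m ∧ (k : ℕ) = 0 then t ^ m else 0

theorem companion_mul_fundMatrix (hm : 1 ≤ m) (t : ℂ) (i k : Fin m) :
    (companion m t * fundMatrix m t) i k = lacunarySeries (gCoeff m k) (2 * m) k (i + 1) t := by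
  rw [Matrix.mul_apply]
  simp only [companion, fundMatrix, Matrix.of_apply, add_mul, ite_mul, one_mul, zero_mul,
    Finset.sum_add_distrib]
  by_cases h : (i : ℕ) + 1 = m
  · rw [Finset.sum_eq_zero, zero_add, Finset.sum_eq_single ⟨0, hm⟩]
    · simp only [h, and_self, if_true]
      exact (lacunarySeries_gCoeff_self hm k.2 t).symm
    · intro l _ hl
      rw [if_neg]
      exact fun h' => hl (Fin.ext h'.2)
    · simp
    · intro l _
      rw [if_neg (by have := l.2; omega)]
  · rw [Finset.sum_eq_single ⟨i + 1, by have := i.2; omega⟩, Finset.sum_eq_zero, add_zero]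
    · simp
    · intro l _
      rw [if_neg (fun h' => h h'.1)]
    · intro l _ hl
      rw [if_neg]
      exact fun h' => hl (Fin.ext h')
    · simp

theorem hasDerivAt_fundMatrix (hm : 1 ≤ m) (t : ℂ) (i k : Fin m) :
    HasDerivAt (fun t => fundMatrix m t i k) ((companion m t * fundMatrix m t) i k) t := by
  rw [companion_mul_fundMatrix hm]
  exact hasDerivAt_lacunarySeries (fun R hR => summable_gCoeff hm k hR) _ _ _ _

theorem hasDerivAt_det {ι : Type*} [Fintype ι] [DecidableEq ι] {M : ℂ → Matrix ι ι ℂ}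
    {M' : Matrix ι ι ℂ} {t : ℂ} (h : ∀ i j, HasDerivAt (fun t => M t i j) (M' i j) t) :
    HasDerivAt (fun t => (M t).det) (∑ i, ((M t).updateRow i (M' i)).det) t := by
  have h1 : ∀ σ : Equiv.Perm ι, HasDerivAt (fun t => ∏ i, M t i (σ i))
      (∑ i, (∏ j ∈ Finset.univ.erase i, M t j (σ j)) • M' i (σ i)) t := fun σ =>
    HasDerivAt.fun_finsetProd fun i _ => h i (σ i)
  have h2 := HasDerivAt.fun_sum (u := Finset.univ) fun (σ : Equiv.Perm ι) _ =>
    (h1 σ).const_mul ((Equiv.Perm.sign σ : ℤ) : ℂ)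
  have e : ∀ N : Matrix ι ι ℂ, N.det =
      ∑ σ : Equiv.Perm ι, ((Equiv.Perm.sign σ : ℤ) : ℂ) * ∏ i, N i (σ i) := fun N => by
    rw [← Matrix.det_transpose, Matrix.det_apply']
    rfl
  simp only [e]
  convert! h2 using 1
  rw [Finset.sum_comm]
  refine Finset.sum_congr rfl fun σ _ => ?_
  rw [Finset.mul_sum]
  refine Finset.sum_congr rfl fun i _ => ?_
  rw [← Finset.prod_erase_mul _ _ (Finset.mem_univ i), Matrix.updateRow_self, smul_eq_mul]
  congr 2
  refine Finset.prod_congr rfl fun j hj => ?_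
  rw [Matrix.updateRow_ne (Finset.ne_of_mem_erase hj)]

/-- Liouville's formula with a traceless companion matrix: the derivative of a row is the next row,
or `t^m` times row `0` for the last one, so each determinant in the Leibniz sum has proportional
rows. For `m = 1` the last row is row `0` itself and the argument breaks down, hence the separate
Gaussian formula. -/
theorem hasDerivAt_det_fundMatrix (hm : 2 ≤ m) (t : ℂ) :
    HasDerivAt (fun t => (fundMatrix m t).det) 0 t := by
  have h := hasDerivAt_det (M := fundMatrix m) (t := t) (hasDerivAt_fundMatrix (by omega) t)
  convert! h using 1
  symm
  refine Finset.sum_eq_zero fun i _ => ?_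
  by_cases hi : (i : ℕ) + 1 = m
  · have h0 : i ≠ ⟨0, by omega⟩ := fun h => by
      have := congrArg Fin.val h
      simp only at this
      omega
    have : (companion m t * fundMatrix m t) i = t ^ m • fundMatrix m t ⟨0, by omega⟩ := by
      ext k
      rw [companion_mul_fundMatrix (by omega), hi, lacunarySeries_gCoeff_self (by omega) k.2]
      rfl
    rw [this, Matrix.det_updateRow_smul, Matrix.det_zero_of_row_eq h0, mul_zero]
    rw [Matrix.updateRow_self, Matrix.updateRow_ne h0.symm]
  · have h0 : i ≠ ⟨i + 1, by omega⟩ := fun h => by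
      have := congrArg Fin.val h
      simp only at this
      omega
    refine Matrix.det_zero_of_row_eq h0 ?_
    rw [Matrix.updateRow_self, Matrix.updateRow_ne h0.symm]
    ext k
    rw [companion_mul_fundMatrix (by omega)]
    rfl

theorem det_fundMatrix (hm : 2 ≤ m) (t : ℂ) : (fundMatrix m t).det = barnesG m := by
  have h := hasDerivAt_det_fundMatrix hm
  rw [is_const_of_deriv_eq_zero (fun t => (h t).differentiableAt) (fun t => (h t).deriv) t 0]
  have : fundMatrix m 0 = Matrix.diagonal fun i : Fin m => ((i : ℕ).factorial : ℂ) := by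
    ext i k
    rw [fundMatrix, Matrix.of_apply, lacunarySeries_gCoeff_zero i.2, Matrix.diagonal_apply]
    by_cases h : i = k
    · simp [h]
    · rw [if_neg h, if_neg (fun h' => h (Fin.ext h'))]
  rw [this, Matrix.det_diagonal, barnesG, Fin.prod_univ_eq_prod_range (fun i => (i.factorial : ℂ)),
    Finset.prod_range_eq_mul_Ico _ (by omega)]
  simp only [Nat.factorial_zero, Nat.cast_one, one_mul]
  congr 1

theorem barnesG_ne_zero (m : ℕ) : barnesG m ≠ 0 :=
  Finset.prod_ne_zero_iff.mpr fun i _ => by exact_mod_cast i.factorial_ne_zero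

theorem differentiable_det {ι : Type*} [Fintype ι] [DecidableEq ι] {M : ℂ → Matrix ι ι ℂ}
    (h : ∀ i j, Differentiable ℂ fun t => M t i j) : Differentiable ℂ fun t => (M t).det :=
  fun t => (hasDerivAt_det (M' := Matrix.of fun i j => deriv (fun t => M t i j) t)
    fun i j => (h i j t).hasDerivAt).differentiableAt

theorem differentiable_adjugate_fundMatrix (hm : 1 ≤ m) (j i : Fin m) :
    Differentiable ℂ fun t => (fundMatrix m t).adjugate j i := by
  simp only [Matrix.adjugate_apply]
  refine differentiable_det fun k l => ?_
  by_cases h : k = i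
  · subst h
    simp only [Matrix.updateRow_self]
    exact differentiable_const _
  · simp only [Matrix.updateRow_ne h]
    exact fun t => (hasDerivAt_fundMatrix hm t k l).differentiableAt

/-- Up to a constant this is `(Φ⁻¹)' = -Φ⁻¹ C`. It follows by differentiating `adj Φ · Φ = G(m+1)`,
multiplying by `adj Φ` on the right and cancelling the nonzero constant. -/
theorem hasDerivAt_adjugate_fundMatrix (hm : 2 ≤ m) (t : ℂ) (j i : Fin m) :
    HasDerivAt (fun t => (fundMatrix m t).adjugate j i)
      (-((fundMatrix m t).adjugate * companion m t) j i) t := by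
  let D : Matrix (Fin m) (Fin m) ℂ :=
    Matrix.of fun j i => deriv (fun t => (fundMatrix m t).adjugate j i) t
  have hD : ∀ j i, HasDerivAt (fun t => (fundMatrix m t).adjugate j i) (D j i) t := fun j i =>
    (differentiable_adjugate_fundMatrix (by omega) j i t).hasDerivAt
  have h1 : D * fundMatrix m t +
      (fundMatrix m t).adjugate * (companion m t * fundMatrix m t) = 0 := by
    ext j l
    have h2 : HasDerivAt (fun t => ((fundMatrix m t).adjugate * fundMatrix m t) j l)
        ((D * fundMatrix m t +
          (fundMatrix m t).adjugate * (companion m t * fundMatrix m t)) j l) t := by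
      simp only [Matrix.mul_apply (M := Matrix.adjugate _), Matrix.add_apply,
        Matrix.mul_apply (M := D), ← Finset.sum_add_distrib]
      exact HasDerivAt.fun_sum fun k _ => (hD j k).mul (hasDerivAt_fundMatrix (by omega) t k l)
    have h3 : (fun t => ((fundMatrix m t).adjugate * fundMatrix m t) j l) =
        fun _ => (barnesG m • (1 : Matrix (Fin m) (Fin m) ℂ)) j l := by
      ext t
      rw [Matrix.adjugate_mul, det_fundMatrix hm]
    rw [h3] at h2
    exact h2.unique (hasDerivAt_const t _)
  have h4 : barnesG m • (D + (fundMatrix m t).adjugate * companion m t) = 0 := by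
    have := congrArg (· * (fundMatrix m t).adjugate) h1
    simp only [zero_mul, add_mul, ← Matrix.mul_assoc] at this
    simp only [Matrix.mul_assoc, Matrix.mul_adjugate, det_fundMatrix hm, Matrix.mul_smul,
      Matrix.mul_one] at this
    rw [smul_add]
    exact this
  have h5 : D = -((fundMatrix m t).adjugate * companion m t) :=
    eq_neg_of_add_eq_zero_left ((smul_eq_zero.mp h4).resolve_left (barnesG_ne_zero m))
  have := hD j i
  rwa [h5] at this

end

section

/-! ### Power moments of the Green function -/

theorem intervalIntegrable_rpow_mul {k : ℝ → ℂ} (hk : Continuous k) {a : ℝ} (ha : -1 < a) :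
    IntervalIntegrable (fun s : ℝ => ((s ^ a : ℝ) : ℂ) * k s) volume 0 1 := by
  have h1 : IntervalIntegrable (fun s : ℝ => ((s ^ a : ℝ) : ℂ)) volume 0 1 :=
    have h := intervalIntegral.intervalIntegrable_rpow' ha
    ⟨h.1.ofReal, h.2.ofReal⟩
  exact h1.mul_continuousOn hk.continuousOn

/-- Integration by parts; `a + 1 > 0` kills the boundary term at `0`, even when `s^a` itself is
unbounded there. -/
theorem add_one_mul_integral_rpow {k k' : ℝ → ℂ} (hk : ∀ s, HasDerivAt k (k' s) s)
    (hk' : Continuous k') {a : ℝ} (ha : -1 < a) :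
    ((a + 1 : ℝ) : ℂ) * ∫ s in (0 : ℝ)..1, ((s ^ a : ℝ) : ℂ) * k s =
      k 1 - ∫ s in (0 : ℝ)..1, ((s ^ (a + 1) : ℝ) : ℂ) * k' s := by
  have hkc : Continuous k := continuous_iff_continuousAt.mpr fun s => (hk s).continuousAt
  have hcont : Continuous fun s : ℝ => ((s ^ (a + 1) : ℝ) : ℂ) * k s :=
    (Complex.continuous_ofReal.comp (Real.continuous_rpow_const (by linarith))).mul hkc
  have i1 := (intervalIntegrable_rpow_mul hkc ha).const_mul ((a + 1 : ℝ) : ℂ)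
  have i2 := intervalIntegrable_rpow_mul hk' (by linarith : -1 < a + 1)
  have h := intervalIntegral.integral_eq_sub_of_hasDerivAt_of_le zero_le_one hcont.continuousOn
    (f' := fun s => ((a + 1 : ℝ) : ℂ) * (((s ^ a : ℝ) : ℂ) * k s) + ((s ^ (a + 1) : ℝ) : ℂ) * k' s)
    (fun s hs => ?_) (i1.add i2)
  · rw [intervalIntegral.integral_add i1 i2, intervalIntegral.integral_const_mul] at h
    rw [eq_sub_iff_add_eq, h, Real.zero_rpow (by linarith : a + 1 ≠ 0)]
    simp
  · have h1 := (Real.hasDerivAt_rpow_const (x := s) (p := a + 1) (Or.inl hs.1.ne')).ofReal_comp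
    convert! h1.mul (hk s) using 1
    rw [add_sub_cancel_right]
    push_cast
    ring

variable {m : ℕ}

/-- Iterating the recursion `p` times yields a partial sum plus a remainder containing `J` at a
shifted argument. The product of Gamma ratios beats any geometric growth and `J` stays bounded, so
the remainder tends to `0`. -/
theorem hasSum_of_recursion (hm : 1 ≤ m) {J : ℝ → ℂ} {x : ℂ} {B : ℝ}
    (hJ : ∀ a : ℝ, -1 < a → J a = (gammaRatio m (a + 1) : ℂ) * x ^ m * (1 + x ^ m * J (a + 2 * m)))
    (hB : ∀ a : ℝ, 0 ≤ a → ‖J a‖ ≤ B) {b : ℝ} (hb : 0 < b) (l : ℕ) :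
    HasSum (fun p : ℕ =>
      ((∏ i ∈ Finset.range (p + 1), gammaRatio m (b + (2 * m : ℕ) * (l + i : ℕ)) : ℝ) : ℂ) *
        x ^ (m + 2 * m * p)) (J (b + (2 * m : ℕ) * l - 1)) := by
  set β : ℕ → ℝ := fun i => gammaRatio m (b + (2 * m : ℕ) * (l + i : ℕ))
  have hδ : 0 < min b 1 := lt_min hb one_pos
  have hm1 : (1 : ℝ) ≤ m := by exact_mod_cast hm
  have hβ0 : ∀ p, 0 ≤ ∏ i ∈ Finset.range p, β i := fun p =>
    Finset.prod_nonneg fun i _ => (gammaRatio_pos _ (by positivity)).le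
  have hstep : ∀ p : ℕ, J (b + (2 * m : ℕ) * (l + p : ℕ) - 1) =
      (β p : ℂ) * x ^ m * (1 + x ^ m * J (b + (2 * m : ℕ) * (l + (p + 1) : ℕ) - 1)) := by
    intro p
    have h0 : 0 < b + (2 * m : ℕ) * (l + p : ℕ) := by positivity
    rw [hJ _ (by linarith), sub_add_cancel,
      show b + ((2 * m : ℕ) : ℝ) * (l + p : ℕ) - 1 + 2 * m =
        b + (2 * m : ℕ) * (l + (p + 1) : ℕ) - 1 by push_cast; ring]
  have hpart : ∀ p : ℕ, J (b + (2 * m : ℕ) * l - 1) =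
      ∑ i ∈ Finset.range p, ((∏ k ∈ Finset.range (i + 1), β k : ℝ) : ℂ) * x ^ (m + 2 * m * i) +
        ((∏ k ∈ Finset.range p, β k : ℝ) : ℂ) * x ^ (2 * m * p) *
          J (b + (2 * m : ℕ) * (l + p : ℕ) - 1) := by
    intro p
    induction p with
    | zero => simp
    | succ p ih =>
      rw [ih, hstep p, Finset.sum_range_succ, Finset.prod_range_succ]
      push_cast
      ring
  have hbd : ∀ p, ∏ k ∈ Finset.range p, β k ≤ (min b 1)⁻¹ ^ p / p.factorial :=
    prod_gammaRatio_le hm hb l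
  have hsum : Summable fun p : ℕ => ((∏ k ∈ Finset.range p, β k : ℝ) : ℂ) * x ^ (2 * m * p) := by
    refine Summable.of_norm_bounded
      (Real.summable_pow_div_factorial ((min b 1)⁻¹ * ‖x‖ ^ (2 * m))) fun p => ?_
    rw [norm_mul, Complex.norm_real, Real.norm_of_nonneg (hβ0 p), norm_pow, mul_pow, ← pow_mul,
      mul_div_right_comm]
    gcongr
    exact hbd p
  have hsum' : Summable fun p : ℕ =>
      ((∏ k ∈ Finset.range (p + 1), β k : ℝ) : ℂ) * x ^ (m + 2 * m * p) := by
    by_cases hx : x = 0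
    · refine summable_zero.congr fun p => ?_
      rw [hx, zero_pow (by omega), mul_zero]
    · refine (((summable_nat_add_iff 1).mpr hsum).mul_right (x ^ m)⁻¹).congr fun p => ?_
      rw [mul_add, mul_one, pow_add x (2 * m * p), pow_add x m, two_mul m, pow_add x m m]
      field_simp
  refine (hsum'.hasSum_iff_tendsto_nat).mpr ?_
  have hrem : Tendsto (fun p : ℕ => ((∏ k ∈ Finset.range p, β k : ℝ) : ℂ) * x ^ (2 * m * p) *
      J (b + (2 * m : ℕ) * (l + p : ℕ) - 1)) atTop (𝓝 0) := by
    have hz := hsum.tendsto_atTop_zero.norm.mul_const B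
    rw [norm_zero, zero_mul] at hz
    refine squeeze_zero_norm' ?_ hz
    -- For `l = p = 0` the argument `b - 1` may be negative, outside the range of the bound on `J`;
    -- from `p = 1` on it is nonnegative.
    filter_upwards [eventually_ge_atTop 1] with p hp
    rw [norm_mul]
    refine mul_le_mul_of_nonneg_left (hB _ ?_) (norm_nonneg _)
    have hp1 : (1 : ℝ) ≤ (l + p : ℕ) := by exact_mod_cast (by omega : 1 ≤ l + p)
    push_cast at hp1 ⊢
    nlinarith
  have := (tendsto_const_nhds (x := J (b + (2 * m : ℕ) * l - 1))).sub hrem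
  rw [sub_zero] at this
  refine this.congr fun p => ?_
  conv_lhs => rw [hpart p]
  ring

/-- `∑_j g_{j+1}(x) Φ(t)⁻¹_{j,i}`, with `m = n + 1`. -/
def greenAux (n : ℕ) (i : Fin (n + 1)) (x t : ℂ) : ℂ :=
  (∑ j, fundMatrix (n + 1) x 0 j * (fundMatrix (n + 1) t).adjugate j i) / barnesG (n + 1)

variable {n : ℕ}

theorem greenAux_self (hn : 1 ≤ n) (i : Fin (n + 1)) (x : ℂ) :
    greenAux n i x x = if i = 0 then 1 else 0 := by
  rw [greenAux, ← Matrix.mul_apply, Matrix.mul_adjugate, det_fundMatrix (by omega),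
    Matrix.smul_apply, Matrix.one_apply]
  have := barnesG_ne_zero (n + 1)
  by_cases h : i = 0
  · simp [h, this]
  · simp [h, Ne.symm h]

theorem hasDerivAt_greenAux (hn : 1 ≤ n) (i : Fin (n + 1)) (x t : ℂ) :
    HasDerivAt (greenAux n i x) (-∑ k, greenAux n k x t * companion (n + 1) t k i) t := by
  have h := (HasDerivAt.fun_sum (u := Finset.univ) fun (j : Fin (n + 1)) _ =>
    (hasDerivAt_adjugate_fundMatrix (by omega : 2 ≤ n + 1) t j i).const_mul
      (fundMatrix (n + 1) x 0 j)).div_const (barnesG (n + 1))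
  convert! h using 1
  simp only [greenAux, Matrix.mul_apply, Finset.sum_div, Finset.sum_mul,
    Finset.mul_sum, mul_neg, Finset.sum_neg_distrib, neg_div]
  rw [Finset.sum_comm]
  congr 1
  refine Finset.sum_congr rfl fun j _ => Finset.sum_congr rfl fun k _ => ?_
  ring

/-- Column `i + 1` of the companion matrix has a single nonzero entry, so differentiation in `t`
lowers the index; at index `0` it returns to the last one with the factor `t^{n+1}`. This cycle
drives the moment recursion. -/
theorem hasDerivAt_greenAux_succ (hn : 1 ≤ n) (i : Fin n) (x t : ℂ) :
    HasDerivAt (greenAux n i.succ x) (-greenAux n i.castSucc x t) t := by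
  convert! hasDerivAt_greenAux hn i.succ x t using 2
  rw [Finset.sum_eq_single i.castSucc]
  · simp [companion]
  · intro k _ hk
    have : (i : ℕ) ≠ k := fun h => hk (Fin.ext h.symm)
    simp [companion, this]
  · simp

theorem hasDerivAt_greenAux_zero (hn : 1 ≤ n) (x t : ℂ) :
    HasDerivAt (greenAux n 0 x) (-(t ^ (n + 1) * greenAux n (Fin.last n) x t)) t := by
  convert! hasDerivAt_greenAux hn 0 x t using 2
  rw [Finset.sum_eq_single (Fin.last n)]
  · simp [companion, mul_comm]
  · intro k _ hk
    have : (k : ℕ) ≠ n := fun h => hk (Fin.ext h)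
    simp [companion, this]
  · simp

theorem continuous_greenAux (hn : 1 ≤ n) (i : Fin (n + 1)) (x : ℂ) : Continuous (greenAux n i x) :=
  continuous_iff_continuousAt.mpr fun t => (hasDerivAt_greenAux hn i x t).continuousAt

theorem hasDerivAt_comp_ofReal_mul {f : ℂ → ℂ} {f' x : ℂ} {s : ℝ}
    (h : HasDerivAt f f' ((s : ℂ) * x)) :
    HasDerivAt (fun s : ℝ => f ((s : ℂ) * x)) (f' * x) s := by
  have h1 : HasDerivAt (fun z : ℂ => z * x) x (s : ℂ) := by
    simpa using (hasDerivAt_id (s : ℂ)).mul_const x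
  have h2 : HasDerivAt (fun z : ℂ => f (z * x)) (f' * x) (s : ℂ) := h.comp (s : ℂ) h1
  exact h2.comp_ofReal

/-- `∫_0^1 s^a k_i(x, s x) ds`. -/
def greenMoment (n : ℕ) (i : Fin (n + 1)) (x : ℂ) (a : ℝ) : ℂ :=
  ∫ s in (0 : ℝ)..1, ((s ^ a : ℝ) : ℂ) * greenAux n i x ((s : ℂ) * x)

theorem greenMoment_succ (hn : 1 ≤ n) (i : Fin n) (x : ℂ) {a : ℝ} (ha : -1 < a) :
    ((a + 1 : ℝ) : ℂ) * greenMoment n i.succ x a = x * greenMoment n i.castSucc x (a + 1) := by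
  have hc : Continuous fun s : ℝ => -greenAux n i.castSucc x ((s : ℂ) * x) * x :=
    (((continuous_greenAux hn i.castSucc x).comp (by fun_prop)).neg).mul_const x
  rw [greenMoment, add_one_mul_integral_rpow
    (fun s => hasDerivAt_comp_ofReal_mul (hasDerivAt_greenAux_succ hn i x _)) hc ha,
    Complex.ofReal_one, one_mul, greenAux_self hn, if_neg (Fin.succ_ne_zero i), zero_sub,
    greenMoment, ← intervalIntegral.integral_const_mul, ← intervalIntegral.integral_neg]
  congr 1
  ext s
  ring

theorem greenMoment_zero (hn : 1 ≤ n) (x : ℂ) {a : ℝ} (ha : -1 < a) :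
    ((a + 1 : ℝ) : ℂ) * greenMoment n 0 x a =
      1 + x ^ (n + 2) * greenMoment n (Fin.last n) x (a + 1 + (n + 1 : ℕ)) := by
  have hc : Continuous fun s : ℝ =>
      -(((s : ℂ) * x) ^ (n + 1) * greenAux n (Fin.last n) x ((s : ℂ) * x)) * x :=
    ((Continuous.mul (by fun_prop)
      ((continuous_greenAux hn (Fin.last n) x).comp (by fun_prop))).neg).mul_const x
  rw [greenMoment, add_one_mul_integral_rpow
    (fun s => hasDerivAt_comp_ofReal_mul (hasDerivAt_greenAux_zero hn x _)) hc ha,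
    Complex.ofReal_one, one_mul, greenAux_self hn, if_pos rfl, sub_eq_add_neg,
    greenMoment, ← intervalIntegral.integral_const_mul, ← intervalIntegral.integral_neg]
  congr 1
  refine intervalIntegral.integral_congr fun s hs => ?_
  rw [Set.uIcc_of_le zero_le_one] at hs
  have h0 : a + 1 + (n + 1 : ℕ) ≠ 0 := by
    have : (0 : ℝ) ≤ (n + 1 : ℕ) := Nat.cast_nonneg _
    linarith
  rw [Real.rpow_add_natCast' hs.1 h0]
  push_cast
  ring

theorem prod_mul_greenMoment (hn : 1 ≤ n) (x : ℂ) (l : ℕ) (hl : l < n + 1) {a : ℝ} (ha : -1 < a) :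
    ((∏ t ∈ Finset.range l, (a + 1 + t) : ℝ) : ℂ) * greenMoment n ⟨l, hl⟩ x a =
      x ^ l * greenMoment n 0 x (a + l) := by
  induction l generalizing a with
  | zero => simp
  | succ l ih =>
    have h1 := greenMoment_succ hn ⟨l, by omega⟩ x ha
    have h2 := ih (by omega) (by linarith : -1 < a + 1)
    simp only [Fin.succ_mk, Fin.castSucc_mk] at h1
    rw [Finset.prod_range_succ', Nat.cast_zero, add_zero, Complex.ofReal_mul, mul_assoc, h1,
      mul_left_comm, show a + ((l + 1 : ℕ) : ℝ) = a + 1 + l by push_cast; ring, pow_succ', mul_assoc,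
      ← h2]
    congr 4
    ext t
    push_cast
    ring

/-- One full turn of the cycle: `n` integrations by parts lead from the last index to index `0`, and
one more back to the last with exponent raised by `2(n+1)` in total. The collected factors `a + 1,
…, a + n + 1` form the Gamma ratio. -/
theorem greenMoment_last (hn : 1 ≤ n) (x : ℂ) {a : ℝ} (ha : -1 < a) :
    x * greenMoment n (Fin.last n) x a = (gammaRatio (n + 1) (a + 1) : ℂ) * x ^ (n + 1) *
      (1 + x ^ (n + 1) * (x * greenMoment n (Fin.last n) x (a + 2 * (n + 1 : ℕ)))) := by
  have h1 := prod_mul_greenMoment hn x n (Nat.lt_succ_self n) ha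
  have hn0 : (0 : ℝ) ≤ n := n.cast_nonneg
  have h2 := greenMoment_zero hn x (by linarith : -1 < a + n)
  have hpos : 0 < ∏ t ∈ Finset.range (n + 1), (a + 1 + t) :=
    Finset.prod_pos fun i _ => by have : (0 : ℝ) ≤ i := i.cast_nonneg; linarith
  have hne : ((∏ t ∈ Finset.range (n + 1), (a + 1 + t) : ℝ) : ℂ) ≠ 0 := by exact_mod_cast hpos.ne'
  have h3 : ((∏ t ∈ Finset.range (n + 1), (a + 1 + t) : ℝ) : ℂ) *
      greenMoment n (Fin.last n) x a =
      x ^ n * (1 + x ^ (n + 2) * greenMoment n (Fin.last n) x (a + 2 * (n + 1 : ℕ))) := by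
    rw [Finset.prod_range_succ, Complex.ofReal_mul,
      show a + 2 * ((n + 1 : ℕ) : ℝ) = a + n + 1 + (n + 1 : ℕ) by push_cast; ring, ← h2,
      show a + 1 + (n : ℝ) = a + n + 1 by ring]
    change ((∏ t ∈ Finset.range n, (a + 1 + t) : ℝ) : ℂ) * greenMoment n (Fin.last n) x a = _ at h1
    linear_combination ((a + n + 1 : ℝ) : ℂ) * h1
  rw [gammaRatio_eq_inv_prod _ (by linarith), Complex.ofReal_inv]
  field_simp
  linear_combination x * h3

end

section

/-! ### Integrals against `F_{m,c}` -/

variable {m : ℕ} {c : ℝ}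

/-- `F_{m,c}(s z w)` at `z = e^Z`, `w = e^W`, without the factor `s^{m(1+c)-1}`. -/
def regularFML (m : ℕ) (c : ℝ) (Z W : ℂ) (s : ℝ) : ℂ :=
  Complex.exp (((m * (1 + c) - 1 : ℝ) : ℂ) * (Z + W)) *
    lacunarySeries (fun k => (Real.Gamma (m * (1 + c) + (2 * m : ℕ) * k))⁻¹) 1 0 0
      (((s : ℂ) * Complex.exp (Z + W)) ^ (2 * m))

theorem summable_inv_Gamma (hm : 1 ≤ m) {b : ℝ} (hb : 0 < b) {R : ℝ} (hR : 0 ≤ R) :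
    Summable fun k : ℕ => |(Real.Gamma (b + (2 * m : ℕ) * k))⁻¹| * R ^ k := by
  refine ((Real.summable_pow_div_factorial ((min b 1)⁻¹ * R)).mul_left
    (Real.Gamma b)⁻¹).of_nonneg_of_le (fun k => by positivity) fun k => ?_
  rw [abs_of_pos (inv_pos.mpr (Real.Gamma_pos_of_pos (by positivity))), mul_pow,
    mul_div_right_comm, ← mul_assoc]
  gcongr
  exact inv_Gamma_add_mul_le hb (by omega) k

theorem exp_log_add {s : ℝ} (hs : 0 < s) (Z W : ℂ) :
    Complex.exp ((Real.log s : ℂ) + Z + W) = (s : ℂ) * Complex.exp (Z + W) := by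
  rw [add_assoc, Complex.exp_add, ← Complex.ofReal_exp, Real.exp_log hs]

/-- Separates the only possible singularity at `s = 0`, the power `s^{m(1+c)-1}`, which is
integrable when `m(1+c) > 0`. -/
theorem FML_log_add (m : ℕ) (c : ℝ) (Z W : ℂ) {s : ℝ} (hs : 0 < s) :
    FML m c ((Real.log s : ℂ) + Z + W) =
      ((s ^ (m * (1 + c) - 1) : ℝ) : ℂ) * regularFML m c Z W s := by
  have h1 : Complex.exp (((m * (1 + c) - 1 : ℝ) : ℂ) * ((Real.log s : ℂ) + Z + W)) =
      ((s ^ (m * (1 + c) - 1) : ℝ) : ℂ) *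
        Complex.exp (((m * (1 + c) - 1 : ℝ) : ℂ) * (Z + W)) := by
    rw [Real.rpow_def_of_pos hs, Complex.ofReal_exp, ← Complex.exp_add]
    congr 1
    push_cast
    ring
  have h2 : ∀ z : ℂ, mittagLeffler (2 * m) (m * (1 + c)) z =
      lacunarySeries (fun k => (Real.Gamma (m * (1 + c) + (2 * m : ℕ) * k))⁻¹) 1 0 0 z := by
    intro z
    refine tsum_congr fun k => ?_
    rw [Nat.descFactorial_zero, add_comm (2 * (m : ℝ) * k)]
    push_cast
    rw [div_eq_mul_inv, mul_comm]
    simp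
  rw [FML, h1, h2, exp_log_add hs, regularFML, mul_assoc]

theorem continuous_regularFML (hm : 1 ≤ m) (hc : -1 < c) (Z W : ℂ) :
    Continuous (regularFML m c Z W) := by
  have h : Continuous (lacunarySeries
      (fun k => (Real.Gamma (m * (1 + c) + (2 * m : ℕ) * k))⁻¹) 1 0 0) :=
    continuous_iff_continuousAt.mpr fun z => (hasDerivAt_lacunarySeries
      (fun R hR => summable_inv_Gamma hm (cast_mul_one_add_pos hm hc) hR) 1 0 0 z).continuousAt
  exact continuous_const.mul (h.comp (by fun_prop))

theorem intervalIntegrable_mul_FML (hm : 1 ≤ m) (hc : -1 < c) {ψ : ℝ → ℂ} (hψ : Continuous ψ)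
    (Z W : ℂ) :
    IntervalIntegrable (fun s : ℝ => ψ s * FML m c ((Real.log s : ℂ) + Z + W)) volume 0 1 := by
  have hb := cast_mul_one_add_pos hm hc
  have h := intervalIntegrable_rpow_mul (hψ.mul (continuous_regularFML hm hc Z W))
    (by linarith : -1 < m * (1 + c) - 1)
  rw [intervalIntegrable_iff, Set.uIoc_of_le zero_le_one] at h ⊢
  refine h.congr_fun (fun s hs => ?_) measurableSet_Ioc
  simp only [FML_log_add m c Z W hs.1, Pi.mul_apply]
  ring

/-- Half of the term `(l, p)` of the double series. -/
def halfTerm (m : ℕ) (b : ℝ) (i : ℕ × ℕ) (u v : ℂ) : ℂ :=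
  (seriesCoeff m b i.1 i.2 : ℂ) * (u ^ (2 * i.1 + 2 * i.2 + 1) * v ^ (2 * i.1))

theorem summable_halfTerm (hm : 1 ≤ m) {b : ℝ} (hb : 0 < b) (u v : ℂ) :
    Summable fun i => halfTerm m b i u v := by
  refine Summable.of_norm_bounded
    (summable_seriesCoeff_mul_pow hm hb (norm_nonneg ((u, v) : ℂ × ℂ)) 1) fun i => ?_
  rw [halfTerm, norm_mul, Complex.norm_real, Real.norm_of_nonneg (seriesCoeff_pos hb _ _).le, one_mul]
  refine mul_le_mul_of_nonneg_left ?_ (seriesCoeff_pos hb _ _).le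
  have h := norm_pow_mul_pow_le (norm_fst_le ((u, v) : ℂ × ℂ)) (norm_snd_le ((u, v) : ℂ × ℂ))
    (2 * i.1 + 2 * i.2 + 1) (2 * i.1)
  rwa [show 2 * i.1 + 2 * i.2 + 1 + 2 * i.1 = 4 * i.1 + 2 * i.2 + 1 by ring] at h

theorem series_eq_sub (hm : 1 ≤ m) {b : ℝ} (hb : 0 < b) (u v : ℂ) :
    series m b (u, v) = ∑' i, halfTerm m b i u v - ∑' i, halfTerm m b i v u := by
  rw [series, ← (summable_halfTerm hm hb u v).tsum_sub (summable_halfTerm hm hb v u)]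
  refine tsum_congr fun i => ?_
  rw [seriesTerm, halfTerm, halfTerm]
  ring

theorem hasSum_integral_mul_FML (hm : 1 ≤ m) (hc : -1 < c) {ψ : ℝ → ℂ} (hψ : Continuous ψ)
    (Z W : ℂ) :
    HasSum (fun l : ℕ => (((Real.Gamma (m * (1 + c) + (2 * m : ℕ) * l))⁻¹ : ℝ) : ℂ) *
        (Complex.exp (((m * (1 + c) - 1 : ℝ) : ℂ) * (Z + W)) * Complex.exp (Z + W) ^ (2 * m * l)) *
        ∫ s in (0 : ℝ)..1, ((s ^ (m * (1 + c) + (2 * m : ℕ) * l - 1) : ℝ) : ℂ) * ψ s)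
      (∫ s in (0 : ℝ)..1, ψ s * FML m c ((Real.log s : ℂ) + Z + W)) := by
  have hb := cast_mul_one_add_pos hm hc
  set b := (m : ℝ) * (1 + c) with hbdef
  set C : ℕ → ℂ := fun l => (((Real.Gamma (b + (2 * m : ℕ) * l))⁻¹ : ℝ) : ℂ) *
        (Complex.exp (((b - 1 : ℝ) : ℂ) * (Z + W)) * Complex.exp (Z + W) ^ (2 * m * l)) with hC
  have hCs : Summable fun l => ‖C l‖ := by
    refine ((summable_inv_Gamma hm hb (by positivity : 0 ≤ ‖Complex.exp (Z + W)‖ ^ (2 * m))).mul_left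
      ‖Complex.exp (((b - 1 : ℝ) : ℂ) * (Z + W))‖).congr fun l => ?_
    simp only [hC]
    rw [norm_mul, norm_mul, norm_pow, Complex.norm_real, Real.norm_eq_abs, ← pow_mul]
    ring
  have hrp : ∀ l : ℕ, -1 < b + (2 * m : ℕ) * l - 1 := fun l => by
    have : (0 : ℝ) ≤ (2 * m : ℕ) * l := by positivity
    linarith
  simp only [← intervalIntegral.integral_const_mul]
  -- On `(0, 1]` raising the exponent only decreases the power, so `s^{b-1} |ψ(s)|` times the
  -- summable constants `‖C l‖` dominates all terms.
  refine intervalIntegral.hasSum_integral_of_dominated_convergence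
    (fun l s => ‖C l‖ * ‖((s ^ (b - 1) : ℝ) : ℂ) * ψ s‖) (fun l => ?_) (fun l => ?_) ?_ ?_ ?_
  · exact ((intervalIntegrable_iff.mp (intervalIntegrable_rpow_mul hψ (hrp l))).const_mul _).1
  · refine ae_of_all _ fun s hs => ?_
    rw [Set.uIoc_of_le zero_le_one] at hs
    rw [norm_mul]
    refine mul_le_mul_of_nonneg_left ?_ (norm_nonneg _)
    rw [norm_mul, norm_mul, Complex.norm_real, Complex.norm_real,
      Real.norm_of_nonneg (Real.rpow_nonneg hs.1.le _),
      Real.norm_of_nonneg (Real.rpow_nonneg hs.1.le _)]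
    refine mul_le_mul_of_nonneg_right ?_ (norm_nonneg _)
    refine Real.rpow_le_rpow_of_exponent_ge hs.1 hs.2 ?_
    have : (0 : ℝ) ≤ (2 * m : ℕ) * l := by positivity
    linarith
  · exact ae_of_all _ fun s _ => hCs.mul_right _
  · simp only [tsum_mul_right]
    exact (intervalIntegrable_rpow_mul hψ (by linarith : -1 < b - 1)).norm.const_mul _
  · refine ae_of_all _ fun s hs => ?_
    rw [Set.uIoc_of_le zero_le_one] at hs
    rw [FML_log_add m c Z W hs.1, regularFML, lacunarySeries, ← hbdef]
    have h := ((summable_lacunary (fun R hR => summable_inv_Gamma hm hb hR) 1 0 0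
      (((s : ℂ) * Complex.exp (Z + W)) ^ (2 * m))).hasSum.mul_left
        (ψ s * ((s ^ (b - 1) : ℝ) : ℂ) * Complex.exp (((b - 1 : ℝ) : ℂ) * (Z + W))))
    convert! h using 1
    · ext l
      rw [show b + ((2 * m : ℕ) : ℝ) * l - 1 = (b - 1) + (2 * m * l : ℕ) by push_cast; ring,
        Real.rpow_add_natCast hs.1.ne']
      simp only [Nat.descFactorial_zero, Nat.cast_one, mul_one, Nat.sub_zero, one_mul, add_zero]
      rw [← pow_mul]
      push_cast
      ring
    · ring

/-- Only the moment recursion of `ψ` is used, so the Gaussian case `m = 1` and the Wronskian case `m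
> 1` are handled together. The absolutely convergent double series is summed over `p` first, at
fixed `l`. -/
theorem integral_mul_FML (hm : 1 ≤ m) (hc : -1 < c) {ψ : ℝ → ℂ} (hψ : Continuous ψ) {Z : ℂ}
    (hrec : ∀ a : ℝ, -1 < a → ∫ s in (0 : ℝ)..1, ((s ^ a : ℝ) : ℂ) * ψ s =
      (gammaRatio m (a + 1) : ℂ) * Complex.exp Z ^ m *
        (1 + Complex.exp Z ^ m * ∫ s in (0 : ℝ)..1, ((s ^ (a + 2 * m) : ℝ) : ℂ) * ψ s)) (W : ℂ) :
    ∫ s in (0 : ℝ)..1, ψ s * FML m c ((Real.log s : ℂ) + Z + W) =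
      Complex.exp (((m * (1 + c) - 1 : ℝ) : ℂ) * (Z + W)) *
        ∑' i, halfTerm m (m * (1 + c)) i (Complex.exp Z ^ m) (Complex.exp W ^ m) := by
  have hb := cast_mul_one_add_pos hm hc
  obtain ⟨B, hB⟩ := (isCompact_Icc (a := (0 : ℝ)) (b := 1)).exists_bound_of_continuousOn
    hψ.continuousOn
  have hJB : ∀ a : ℝ, 0 ≤ a → ‖∫ s in (0 : ℝ)..1, ((s ^ a : ℝ) : ℂ) * ψ s‖ ≤ B := by
    intro a ha
    refine (intervalIntegral.norm_integral_le_of_norm_le_const (C := B) fun s hs => ?_).trans_eq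
      (by simp)
    rw [Set.uIoc_of_le zero_le_one] at hs
    rw [norm_mul, Complex.norm_real, Real.norm_of_nonneg (Real.rpow_nonneg hs.1.le _)]
    have h1 := hB s ⟨hs.1.le, hs.2⟩
    calc _ ≤ 1 * ‖ψ s‖ := by gcongr; exact Real.rpow_le_one hs.1.le hs.2 ha
      _ ≤ B := by rwa [one_mul]
  have h1 := hasSum_integral_mul_FML hm hc hψ Z W
  have h2 := (summable_halfTerm hm hb (Complex.exp Z ^ m) (Complex.exp W ^ m)).hasSum.mul_left
    (Complex.exp (((m * (1 + c) - 1 : ℝ) : ℂ) * (Z + W)))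
  refine h1.unique (h2.prod_fiberwise fun l => ?_)
  have h3 := (hasSum_of_recursion hm hrec hJB hb l).mul_left
    ((((Real.Gamma (m * (1 + c) + (2 * m : ℕ) * l))⁻¹ : ℝ) : ℂ) *
      (Complex.exp (((m * (1 + c) - 1 : ℝ) : ℂ) * (Z + W)) * Complex.exp (Z + W) ^ (2 * m * l)))
  convert! h3 using 1
  ext p
  simp only [halfTerm, seriesCoeff]
  rw [Complex.exp_add Z W]
  push_cast
  ring

/-! ### The explicit pre-kernel -/

theorem integral_rpow_mul_gaussian (x : ℂ) {a : ℝ} (ha : -1 < a) :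
    ∫ s in (0 : ℝ)..1, ((s ^ a : ℝ) : ℂ) *
        (x * Complex.exp (1 / 2 * (1 - (s : ℂ) ^ 2) * x ^ 2)) =
      (gammaRatio 1 (a + 1) : ℂ) * x ^ 1 * (1 + x ^ 1 *
        ∫ s in (0 : ℝ)..1, ((s ^ (a + 2 * (1 : ℕ)) : ℝ) : ℂ) *
          (x * Complex.exp (1 / 2 * (1 - (s : ℂ) ^ 2) * x ^ 2))) := by
  have hd : ∀ s : ℝ, HasDerivAt (fun s : ℝ => x * Complex.exp (1 / 2 * (1 - (s : ℂ) ^ 2) * x ^ 2))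
      (-(s : ℂ) * x ^ 2 * (x * Complex.exp (1 / 2 * (1 - (s : ℂ) ^ 2) * x ^ 2))) s := by
    intro s
    have h1 : HasDerivAt (fun z : ℂ => 1 / 2 * (1 - z ^ 2) * x ^ 2) (-(s : ℂ) * x ^ 2) (s : ℂ) := by
      convert! ((((hasDerivAt_pow 2 (s : ℂ)).const_sub 1).const_mul (1 / 2)).mul_const (x ^ 2)) using 1
      push_cast
      ring
    convert! (h1.cexp.const_mul x).comp_ofReal using 1
    ring
  have h := add_one_mul_integral_rpow hd (by fun_prop) ha
  have e : ∫ s in (0 : ℝ)..1, ((s ^ (a + 1) : ℝ) : ℂ) *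
      (-(s : ℂ) * x ^ 2 * (x * Complex.exp (1 / 2 * (1 - (s : ℂ) ^ 2) * x ^ 2))) =
      -x ^ 2 * ∫ s in (0 : ℝ)..1, ((s ^ (a + 2 * (1 : ℕ)) : ℝ) : ℂ) *
        (x * Complex.exp (1 / 2 * (1 - (s : ℂ) ^ 2) * x ^ 2)) := by
    rw [← intervalIntegral.integral_const_mul]
    refine intervalIntegral.integral_congr fun s hs => ?_
    rw [Set.uIcc_of_le zero_le_one] at hs
    rw [show a + 2 * ((1 : ℕ) : ℝ) = a + 1 + (1 : ℕ) by push_cast; ring,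
      Real.rpow_add_natCast' hs.1 (by push_cast; linarith)]
    push_cast
    ring
  rw [e] at h
  have hne : ((a + 1 : ℝ) : ℂ) ≠ 0 := by exact_mod_cast (by linarith : a + 1 ≠ 0)
  rw [gammaRatio_eq_inv_prod 1 (by linarith)]
  simp only [Finset.prod_range_one, Nat.cast_zero, add_zero, pow_one]
  rw [show 1 / 2 * (1 - ((1 : ℝ) : ℂ) ^ 2) * x ^ 2 = 0 by push_cast; ring, Complex.exp_zero,
    mul_one] at h
  rw [Complex.ofReal_inv, mul_assoc, eq_inv_mul_iff_mul_eq₀ hne, h]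
  ring

/-- Deleting the highest derivative row and one function leaves exactly the Wronskian of the
remaining functions, and the cofactor sign is `(-1)^{n+k} = (-1)^{n-k}`. -/
theorem adjugate_fundMatrix_last (n : ℕ) (t : ℂ) (k : Fin (n + 1)) :
    (fundMatrix (n + 1) t).adjugate k (Fin.last n) = (-1) ^ (n - (k : ℕ)) * Wminor (n + 1) (k + 1) t := by
  rw [Matrix.adjugate_fin_succ_eq_det_submatrix, Wminor, wronskian]
  congr 1
  · rw [Fin.val_last, show n + (k : ℕ) = (n - k) + 2 * k by omega, pow_add, pow_mul]
    simp
  · change _ = Matrix.det (n := Fin n) _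
    congr 1
    ext i l
    simp only [Matrix.submatrix_apply, Fin.succAbove_last, fundMatrix, Matrix.of_apply,
      Fin.val_castSucc]
    have h : (if (l : ℕ) + 1 < k + 1 then (l : ℕ) + 1 else l + 2) = (k.succAbove l : ℕ) + 1 := by
      rw [Fin.succAbove]
      split_ifs with h1 h2 h2
      · simp
      · exact absurd (Fin.lt_def.mpr (by simpa using h1)) h2
      · exact absurd (Fin.lt_def.mp h2) (by simpa using h1)
      · simp
    rw [h, g_eq_lacunarySeries (by omega),
      iteratedDeriv_lacunarySeries (fun R hR => summable_gCoeff (by omega) _ hR)]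

theorem continuous_Wminor (n j : ℕ) (hj : j ∈ Finset.Icc 1 (n + 1)) :
    Continuous (Wminor (n + 1) j) := by
  rw [Finset.mem_Icc] at hj
  obtain ⟨k, rfl⟩ := Nat.exists_eq_add_of_le' hj.1
  have h := (differentiable_adjugate_fundMatrix (by omega : 1 ≤ n + 1) ⟨k, by omega⟩
    (Fin.last n)).continuous
  simp only [adjugate_fundMatrix_last] at h
  refine (h.const_mul ((-1) ^ (n - k))).congr fun t => ?_
  rw [← mul_assoc, ← mul_pow]
  simp

theorem sum_g_mul_Wminor (n : ℕ) (x t : ℂ) :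
    ∑ j ∈ Finset.Icc 1 (n + 1), (-1 : ℂ) ^ (n + 1 - j) / barnesG (n + 1) *
      (x * g (n + 1) j x * Wminor (n + 1) j t) = x * greenAux n (Fin.last n) x t := by
  rw [Finset.sum_bij' (t := Finset.range (n + 1)) (i := fun j _ => j - 1) (j := fun k _ => k + 1)
    (g := fun k => (-1 : ℂ) ^ (n - k) / barnesG (n + 1) *
      (x * g (n + 1) (k + 1) x * Wminor (n + 1) (k + 1) t))]
  · rw [← Fin.sum_univ_eq_sum_range (fun k => (-1 : ℂ) ^ (n - k) / barnesG (n + 1) *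
      (x * g (n + 1) (k + 1) x * Wminor (n + 1) (k + 1) t)), greenAux, Finset.sum_div,
      Finset.mul_sum]
    refine Finset.sum_congr rfl fun k _ => ?_
    rw [adjugate_fundMatrix_last, g_eq_lacunarySeries (by omega)]
    simp only [fundMatrix, Matrix.of_apply, Fin.val_zero]
    ring
  · intro j hj
    rw [Finset.mem_Icc] at hj
    rw [Finset.mem_range]
    omega
  · intro k hk
    rw [Finset.mem_range] at hk
    rw [Finset.mem_Icc]
    omega
  · intro j hj
    rw [Finset.mem_Icc] at hj
    omega
  · intro k _
    simp
  · intro j hj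
    rw [Finset.mem_Icc] at hj
    rw [show n - (j - 1) = n + 1 - j by omega, show j - 1 + 1 = j by omega]

theorem intervalIntegrable_integrandOne (hc : -1 < c) (Z W : ℂ) :
    IntervalIntegrable (integrandOne c Z W) volume 0 1 :=
  intervalIntegrable_mul_FML le_rfl hc (by fun_prop) Z W

theorem intervalIntegrable_integrand (hm : 1 ≤ m) (hc : -1 < c) {j : ℕ} (hj : j ∈ Finset.Icc 1 m)
    (Z W : ℂ) : IntervalIntegrable (integrand m c j Z W) volume 0 1 := by
  obtain ⟨n, rfl⟩ := Nat.exists_eq_add_of_le' hm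
  have hW := continuous_Wminor n j hj
  exact intervalIntegrable_mul_FML hm hc (by fun_prop) Z W

theorem kappaTilde_of_moments (hm : 1 ≤ m) (hc : -1 < c) {ψ : ℂ → ℝ → ℂ}
    (hψ : ∀ Z, Continuous (ψ Z))
    (hrec : ∀ (Z : ℂ) (a : ℝ), -1 < a → ∫ s in (0 : ℝ)..1, ((s ^ a : ℝ) : ℂ) * ψ Z s =
      (gammaRatio m (a + 1) : ℂ) * Complex.exp Z ^ m *
        (1 + Complex.exp Z ^ m * ∫ s in (0 : ℝ)..1, ((s ^ (a + 2 * m) : ℝ) : ℂ) * ψ Z s))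
    (Z W : ℂ) :
    ∫ s in (0 : ℝ)..1, (ψ Z s - ψ W s) * FML m c ((Real.log s : ℂ) + Z + W) =
      Complex.exp (((m * (1 + c) - 1 : ℝ) : ℂ) * (Z + W)) *
        series m (m * (1 + c)) (Complex.exp Z ^ m, Complex.exp W ^ m) := by
  have h1 := integral_mul_FML hm hc (hψ Z) (hrec Z) W
  have h2 := integral_mul_FML hm hc (hψ W) (hrec W) Z
  simp only [add_right_comm _ W Z, add_comm W Z] at h2
  simp only [sub_mul]
  rw [intervalIntegral.integral_sub (intervalIntegrable_mul_FML hm hc (hψ Z) Z W)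
    (intervalIntegrable_mul_FML hm hc (hψ W) Z W), h1, h2,
    series_eq_sub hm (cast_mul_one_add_pos hm hc), mul_sub]

theorem kappaTilde_eq (hm : 1 ≤ m) (hc : -1 < c) (Z W : ℂ) :
    kappaTilde m c Z W = Complex.exp (((m * (1 + c) - 1 : ℝ) : ℂ) * (Z + W)) *
      series m (m * (1 + c)) (Complex.exp Z ^ m, Complex.exp W ^ m) := by
  rw [kappaTilde]
  split_ifs with h
  · subst h
    exact kappaTilde_of_moments le_rfl hc (ψ := fun Z s =>
      Complex.exp Z * Complex.exp (1 / 2 * (1 - (s : ℂ) ^ 2) * Complex.exp Z ^ 2))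
      (fun Z => by fun_prop) (fun Z a ha => integral_rpow_mul_gaussian _ ha) Z W
  · obtain ⟨n, rfl⟩ := Nat.exists_eq_add_of_le' hm
    have hn : 1 ≤ n := by omega
    rw [← kappaTilde_of_moments hm hc (ψ := fun Z s =>
      Complex.exp Z * greenAux n (Fin.last n) (Complex.exp Z) ((s : ℂ) * Complex.exp Z))
      (fun Z => continuous_const.mul
        ((continuous_greenAux hn (Fin.last n) (Complex.exp Z)).comp (by fun_prop)))
      (fun Z a ha => ?_) Z W]
    · simp only [← intervalIntegral.integral_const_mul]
      rw [← intervalIntegral.integral_finsetSum fun j hj =>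
        (intervalIntegrable_integrand hm hc hj Z W).const_mul _]
      congr 1
      ext s
      rw [← sum_g_mul_Wminor, ← sum_g_mul_Wminor, ← Finset.sum_sub_distrib, Finset.sum_mul]
      refine Finset.sum_congr rfl fun j _ => ?_
      rw [integrand]
      ring
    · have h := greenMoment_last hn (Complex.exp Z) ha
      have e : ∀ a : ℝ, ∫ s in (0 : ℝ)..1, ((s ^ a : ℝ) : ℂ) * (Complex.exp Z *
          greenAux n (Fin.last n) (Complex.exp Z) ((s : ℂ) * Complex.exp Z)) =
          Complex.exp Z * greenMoment n (Fin.last n) (Complex.exp Z) a := by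
        intro a
        rw [greenMoment, ← intervalIntegral.integral_const_mul]
        congr 1
        ext s
        ring
      rw [e, e]
      exact h

/-- The `m`-th power of `√(2m) z^{1/m}` is `ρz`, so the series becomes one in integer powers of `z`
and `w`. The exponents of `zw` outside it add up to `(1/m - 1) + (m(1+c) - 1)/m = c`. -/
theorem kappa_eq (hm : 1 ≤ m) (hc : -1 < c) (Z W : ℂ) :
    kappa m c Z W =
      Complex.exp ((c : ℂ) * (Z + W)) * entireKernel m c (Complex.exp Z, Complex.exp W) := by
  have h1 : (0 : ℝ) < m := by exact_mod_cast hm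
  have hmC : (m : ℂ) ≠ 0 := by exact_mod_cast h1.ne'
  have e0 : 2 / (1 / (m : ℝ)) = 2 * m := by field_simp
  have e1 : 1 / (2 * (1 / (m : ℝ))) = (m : ℝ) / 2 := by field_simp
  have hpow : ∀ Z, Complex.exp (logScale (1 / (m : ℝ)) Z) ^ m =
      (scaleConst m : ℂ) * Complex.exp Z := by
    intro Z
    rw [← Complex.exp_nat_mul, logScale, e0, scaleConst, Real.rpow_def_of_pos (by positivity),
      Complex.ofReal_exp, ← Complex.exp_add, Real.log_sqrt (by positivity)]
    congr 1
    push_cast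
    field_simp
  rw [kappa, kappaTilde_eq hm hc, hpow, hpow, entireKernel, e0, e1, ← scaleConst]
  have hexp : Complex.exp (((1 / (m : ℝ) - 1 : ℝ) : ℂ) * (Z + W)) *
      Complex.exp (((m * (1 + c) - 1 : ℝ) : ℂ) *
        (logScale (1 / (m : ℝ)) Z + logScale (1 / (m : ℝ)) W)) =
      Complex.exp ((c : ℂ) * (Z + W)) * (((2 * (m : ℝ)) ^ (m * (1 + c) - 1) : ℝ) : ℂ) := by
    rw [Real.rpow_def_of_pos (by positivity), Complex.ofReal_exp, ← Complex.exp_add,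
      ← Complex.exp_add, logScale, logScale, e0, Real.log_sqrt (by positivity)]
    congr 1
    push_cast
    field_simp
    ring
  rw [Complex.ofReal_mul]
  linear_combination ((scaleConst m : ℂ) * series m (m * (1 + c))
    ((scaleConst m : ℂ) * Complex.exp Z, (scaleConst m : ℂ) * Complex.exp W)) * hexp

end

end MittagLefflerKernel

end

theorem mainTheorem3 (m : ℕ) (hm : 1 ≤ m) (c : ℝ) (hc : -1 < c) :
    -- skew-orthogonal polynomials exist, so that the kernels below are there
    (∀ N : ℕ, 1 ≤ N → ∃ (q : ℕ → Polynomial ℝ) (s : ℕ → ℝ),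
      MittagLefflerKernel.IsSkewOrthogonal N
        (MittagLefflerKernel.potential (1 / (m : ℝ)) c N) q s) ∧
    -- the integrals in the explicit formula converge absolutely
    (m = 1 → ∀ Z W : ℂ,
      IntervalIntegrable (MittagLefflerKernel.integrandOne c Z W) volume 0 1) ∧
    (1 < m → ∀ j ∈ Finset.Icc 1 m, ∀ Z W : ℂ,
      IntervalIntegrable (MittagLefflerKernel.integrand m c j Z W) volume 0 1) ∧
    (∀ (q : ℕ → ℕ → Polynomial ℝ) (s : ℕ → ℕ → ℝ),
      (∀ N : ℕ, 1 ≤ N → MittagLefflerKernel.IsSkewOrthogonal N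
        (MittagLefflerKernel.potential (1 / (m : ℝ)) c N) (q N) (s N)) →
      -- the rescaled kernels converge to the kernel with the explicit pre-kernel
      TendstoLocallyUniformly
        (fun (N : ℕ) (p : ℂ × ℂ) =>
          MittagLefflerKernel.finiteKernel (1 / (m : ℝ)) c N (q N) (s N) p.1 p.2)
        (fun p : ℂ × ℂ =>
          MittagLefflerKernel.limitKernel (1 / (m : ℝ)) (MittagLefflerKernel.kappa m c) p.1 p.2)
        atTop ∧
      -- the normalised pre-kernels converge on all of `ℂ × ℂ`, the origin included, and the
      -- explicit pre-kernel is `(z w) ^ c` times the limit, an entire function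
      ∃ P : ℂ × ℂ → ℂ, Differentiable ℂ P ∧
        TendstoLocallyUniformly
          (fun (N : ℕ) (p : ℂ × ℂ) =>
            ((MittagLefflerKernel.microScale (1 / (m : ℝ)) N ^ (2 * c) : ℝ) : ℂ) *
              MittagLefflerKernel.rescaledPreKernel (1 / (m : ℝ)) N (q N) (s N) p.1 p.2)
          P atTop ∧
        ∀ Z W : ℂ, MittagLefflerKernel.kappa m c Z W =
          Complex.exp ((c : ℂ) * (Z + W)) * P (Complex.exp Z, Complex.exp W)) := by
  have hκ := MittagLefflerKernel.kappa_eq (m := m) (c := c) hm hc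
  refine ⟨fun N hN => ⟨_, _, MittagLefflerKernel.isSkewOrthogonal_skewPoly hm hc hN⟩, ?_, ?_, ?_⟩
  · intro _ Z W
    exact MittagLefflerKernel.intervalIntegrable_integrandOne hc Z W
  · intro _ j hj Z W
    exact MittagLefflerKernel.intervalIntegrable_integrand hm hc hj Z W
  · intro q s h
    exact ⟨MittagLefflerKernel.tendstoLocallyUniformly_finiteKernel hm hc h hκ,
      MittagLefflerKernel.entireKernel m c, MittagLefflerKernel.differentiable_entireKernel hm hc,
      MittagLefflerKernel.tendstoLocallyUniformly_rescaledPreKernel hm hc h, hκ⟩
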